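/- Let $d,m\in\mathbb{N}$ with $d\ge 2$. For an open set $O\subset\mathbb{R}^d$ let $W^{1,1}(O,\mathbb{R}^m)$ be the space of all $u\in L^1(O,\mathbb{R}^m)$ with a weak gradient $\nabla u\in L^1(O,\mathbb{R}^{m\times d})$, with norm $\|u\|_{L^1(O)}+\|\nabla u\|_{L^1(O)}$. Then every $u\in W^{1,1}(\mathbb{R}^d,\mathbb{R}^m)$ belongs to $L^{d/(d-1)}(\mathbb{R}^d,\mathbb{R}^m)$, the linear embedding $W^{1,1}(\mathbb{R}^d,\mathbb{R}^m)\hookrightarrow L^{d/(d-1)}(\mathbb{R}^d,\mathbb{R}^m)$ is bounded, and it is completely continuous: whenever $(u_n)_{n\in\mathbb{N}}\subset W^{1,1}(\mathbb{R}^d,\mathbb{R}^m)$ and $u_n\rightharpoonup u$ weakly in $W^{1,1}(\mathbb{R}^d,\mathbb{R}^m)$, then $u_n\to u$ strongly in $L^{d/(d-1)}(\mathbb{R}^d,\mathbb{R}^m)$. The embedding is not compact if $m\ge 1$. The same holds when $\mathbb{R}^d$ is replaced by any $W^{1,1}$-extension domain $O$, that is, an open set $O\subset\mathbb{R}^d$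 for which there is a bounded linear operator $E:W^{1,1}(O,\mathbb{R}^m)\to W^{1,1}(\mathbb{R}^d,\mathbb{R}^m)$ with $Eu=u$ a.e. on $O$ for all $u\in W^{1,1}(O,\mathbb{R}^m)$ (for the non-compactness, $O$ is non-empty and $m\ge 1$). -/

import Mathlib

open MeasureTheory Filter Topology
open scoped ENNReal ContDiff

noncomputable section

/-- `G` is a weak (distributional) derivative of `u` on the open set `O`: for every smooth test
function `φ` with compact support in `O` and every direction `v`,
`∫_O (∂_v φ) u = - ∫_O φ (G v)`. -/
def HasWeakFDerivOn {d m : ℕ} (O : Set (EuclideanSpace ℝ (Fin d)))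
    (u : EuclideanSpace ℝ (Fin d) → EuclideanSpace ℝ (Fin m))
    (G : EuclideanSpace ℝ (Fin d) → (EuclideanSpace ℝ (Fin d) →L[ℝ] EuclideanSpace ℝ (Fin m))) :
    Prop :=
  ∀ φ : EuclideanSpace ℝ (Fin d) → ℝ, ContDiff ℝ ∞ φ → HasCompactSupport φ → tsupport φ ⊆ O →
    ∀ v : EuclideanSpace ℝ (Fin d),
      ∫ x in O, (fderiv ℝ φ x v) • u x = - ∫ x in O, φ x • (G x v)

/-- The space of pairs in `L¹(O, ℝᵐ) × L¹(O, ℝ^{m × d})`, normed by the sum of the two norms. -/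
abbrev L1Pair (d m : ℕ) (O : Set (EuclideanSpace ℝ (Fin d))) : Type :=
  WithLp 1
    (Lp (EuclideanSpace ℝ (Fin m)) 1 (volume.restrict O) ×
      Lp (EuclideanSpace ℝ (Fin d) →L[ℝ] EuclideanSpace ℝ (Fin m)) 1 (volume.restrict O))

theorem integrable_fderiv_smul {d m : ℕ} {O : Set (EuclideanSpace ℝ (Fin d))}
    {φ : EuclideanSpace ℝ (Fin d) → ℝ} (hφ : ContDiff ℝ ∞ φ) (hc : HasCompactSupport φ)
    (v : EuclideanSpace ℝ (Fin d))
    (u : Lp (EuclideanSpace ℝ (Fin m)) 1 (volume.restrict O)) :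
    Integrable (fun x => (fderiv ℝ φ x v) • u x) (volume.restrict O) := by
  have hcont : Continuous (fun x => fderiv ℝ φ x v) :=
    (hφ.continuous_fderiv (by simp)).clm_apply continuous_const
  have hcs : HasCompactSupport (fun x => fderiv ℝ φ x v) := hc.fderiv_apply ℝ v
  obtain ⟨C, hC⟩ := hcs.exists_bound_of_continuous hcont
  exact (L1.integrable_coeFn u).bdd_smul C hcont.aestronglyMeasurable
    (Eventually.of_forall hC)

theorem integrable_smul_apply {d m : ℕ} {O : Set (EuclideanSpace ℝ (Fin d))}
    {φ : EuclideanSpace ℝ (Fin d) → ℝ} (hφ : ContDiff ℝ ∞ φ) (hc : HasCompactSupport φ)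
    (v : EuclideanSpace ℝ (Fin d))
    (G : Lp (EuclideanSpace ℝ (Fin d) →L[ℝ] EuclideanSpace ℝ (Fin m)) 1 (volume.restrict O)) :
    Integrable (fun x => φ x • (G x v)) (volume.restrict O) := by
  obtain ⟨C, hC⟩ := hc.exists_bound_of_continuous hφ.continuous
  exact ((L1.integrable_coeFn G).apply_continuousLinearMap v).bdd_smul C
    hφ.continuous.aestronglyMeasurable (Eventually.of_forall hC)

/-- The Sobolev space `W^{1,1}(O, ℝᵐ)`, as the space of pairs `(u, ∇u)` where `u ∈ L¹(O, ℝᵐ)` has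
the weak derivative `∇u ∈ L¹(O, ℝ^{m × d})`. For open `O` the second entry is determined by the
first. The norm is `‖u‖_{L¹} + ‖∇u‖_{L¹}`. -/
def W11 (d m : ℕ) (O : Set (EuclideanSpace ℝ (Fin d))) : Submodule ℝ (L1Pair d m O) where
  carrier := {w | HasWeakFDerivOn O (w.fst : EuclideanSpace ℝ (Fin d) → _) w.snd}
  zero_mem' := by
    intro φ _ _ _ v
    have h1 : ∫ x in O, (fderiv ℝ φ x v) •
        ((0 : Lp (EuclideanSpace ℝ (Fin m)) 1 (volume.restrict O)) x) = 0 := by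
      rw [← integral_zero (EuclideanSpace ℝ (Fin d)) (EuclideanSpace ℝ (Fin m))
      (μ := volume.restrict O)]
      refine integral_congr_ae ?_
      filter_upwards [Lp.coeFn_zero (EuclideanSpace ℝ (Fin m)) 1 (volume.restrict O)] with x hx
      simp only [hx, Pi.zero_apply, smul_zero]
    have h2 : ∫ x in O, φ x • ((0 : Lp (EuclideanSpace ℝ (Fin d) →L[ℝ] EuclideanSpace ℝ (Fin m)) 1
        (volume.restrict O)) x v) = 0 := by
      rw [← integral_zero (EuclideanSpace ℝ (Fin d)) (EuclideanSpace ℝ (Fin m))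
      (μ := volume.restrict O)]
      refine integral_congr_ae ?_
      filter_upwards [Lp.coeFn_zero (EuclideanSpace ℝ (Fin d) →L[ℝ] EuclideanSpace ℝ (Fin m)) 1
        (volume.restrict O)] with x hx
      simp only [hx, Pi.zero_apply, zero_apply, smul_zero]
    simp only [WithLp.zero_fst, WithLp.zero_snd]
    rw [h1, h2, neg_zero]
  add_mem' := by
    intro a b ha hb φ hφ hc hs v
    have h1 : ∫ x in O, (fderiv ℝ φ x v) • ((a.fst + b.fst) x) =
        (∫ x in O, (fderiv ℝ φ x v) • (a.fst x)) + ∫ x in O, (fderiv ℝ φ x v) • (b.fst x) := by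
      rw [← integral_add (integrable_fderiv_smul hφ hc v _) (integrable_fderiv_smul hφ hc v _)]
      refine integral_congr_ae ?_
      filter_upwards [Lp.coeFn_add a.fst b.fst] with x hx
      simp only [hx, Pi.add_apply, smul_add]
    have h2 : ∫ x in O, φ x • ((a.snd + b.snd) x v) =
        (∫ x in O, φ x • (a.snd x v)) + ∫ x in O, φ x • (b.snd x v) := by
      rw [← integral_add (integrable_smul_apply hφ hc v _) (integrable_smul_apply hφ hc v _)]
      refine integral_congr_ae ?_
      filter_upwards [Lp.coeFn_add a.snd b.snd] with x hx
      simp only [hx, Pi.add_apply, add_apply, smul_add]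
    simp only [WithLp.add_fst, WithLp.add_snd]
    rw [h1, h2, ha φ hφ hc hs v, hb φ hφ hc hs v, neg_add]
  smul_mem' := by
    intro c a ha φ hφ hc hs v
    have h1 : ∫ x in O, (fderiv ℝ φ x v) • ((c • a.fst) x) =
        c • ∫ x in O, (fderiv ℝ φ x v) • (a.fst x) := by
      rw [← integral_smul]
      refine integral_congr_ae ?_
      filter_upwards [Lp.coeFn_smul c a.fst] with x hx
      simp only [hx, Pi.smul_apply]
      rw [smul_comm]
    have h2 : ∫ x in O, φ x • ((c • a.snd) x v) = c • ∫ x in O, φ x • (a.snd x v) := by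
      rw [← integral_smul]
      refine integral_congr_ae ?_
      filter_upwards [Lp.coeFn_smul c a.snd] with x hx
      simp only [hx, Pi.smul_apply, smul_apply]
      rw [smul_comm]
    simp only [WithLp.smul_fst, WithLp.smul_snd]
    rw [h1, h2, ha φ hφ hc hs v, smul_neg]

/-- The underlying (class of a) function of an element of `W^{1,1}(O, ℝᵐ)`. -/
def W11.toL1 {d m : ℕ} {O : Set (EuclideanSpace ℝ (Fin d))} (w : W11 d m O) :
    Lp (EuclideanSpace ℝ (Fin m)) 1 (volume.restrict O) :=
  w.1.fst

/-- The weak gradient of an element of `W^{1,1}(O, ℝᵐ)`. -/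
def W11.grad {d m : ℕ} {O : Set (EuclideanSpace ℝ (Fin d))} (w : W11 d m O) :
    Lp (EuclideanSpace ℝ (Fin d) →L[ℝ] EuclideanSpace ℝ (Fin m)) 1 (volume.restrict O) :=
  w.1.snd

/-- `O` is an open set with a bounded linear extension operator
`E : W^{1,1}(O, ℝᵐ) → W^{1,1}(ℝᵈ, ℝᵐ)`, `E u = u` almost everywhere on `O`. -/
def IsW11ExtensionDomain (d m : ℕ) (O : Set (EuclideanSpace ℝ (Fin d))) : Prop :=
  IsOpen O ∧ ∃ E : W11 d m O →L[ℝ] W11 d m Set.univ,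
    ∀ w : W11 d m O, W11.toL1 (E w) =ᵐ[volume.restrict O] W11.toL1 w

/-- The critical Sobolev exponent `d / (d - 1)`. -/
def critExp (d : ℕ) : ℝ≥0∞ := ENNReal.ofReal ((d : ℝ) / ((d : ℝ) - 1))

instance fact_one_le_critExp (d : ℕ) [hd : Fact (2 ≤ d)] : Fact (1 ≤ critExp d) := by
  refine ⟨?_⟩
  have h2 : (2 : ℝ) ≤ d := by exact_mod_cast hd.out
  rw [critExp, ENNReal.one_le_ofReal, le_div_iff₀ (by linarith)]
  linarith

/-- The space `L^{d/(d-1)}(O, ℝᵐ)`. -/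
abbrev LCrit (d m : ℕ) (O : Set (EuclideanSpace ℝ (Fin d))) : Type :=
  Lp (EuclideanSpace ℝ (Fin m)) (critExp d) (volume.restrict O)

/-- The bounded operator `T : W^{1,1}(O, ℝᵐ) → L^{d/(d-1)}(O, ℝᵐ)` is the embedding, that is,
`T u = u` almost everywhere on `O`. -/
def IsSobolevEmbedding {d m : ℕ} [Fact (2 ≤ d)] {O : Set (EuclideanSpace ℝ (Fin d))}
    (T : W11 d m O →L[ℝ] LCrit d m O) : Prop :=
  ∀ w : W11 d m O, T w =ᵐ[volume.restrict O] W11.toL1 w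

/-- Weak convergence of the sequence `x` to `y`: `f (x n) → f y` for every `f` in
the dual space. -/
def WeaklyConverges {X : Type*} [NormedAddCommGroup X] [NormedSpace ℝ X] (x : ℕ → X) (y : X) :
    Prop :=
  ∀ f : X →L[ℝ] ℝ, Tendsto (fun n => f (x n)) atTop (𝓝 (f y))

/-- A completely continuous operator: it maps weakly convergent sequences to norm convergent
sequences, with the expected limit. -/
def IsCompletelyContinuous {X Y : Type*} [NormedAddCommGroup X] [NormedSpace ℝ X]
    [NormedAddCommGroup Y] [NormedSpace ℝ Y] (T : X →L[ℝ] Y) : Prop :=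
  ∀ (x : ℕ → X) (y : X), WeaklyConverges x y → Tendsto (fun n => T (x n)) atTop (𝓝 (T y))

end

/-!
The critical Sobolev embedding of `W^{1,1}` is not compact, because a function can concentrate at a
point while its gradient keeps its `L¹` norm. Weak convergence in `L¹` rules this out: weakly
convergent sequences in `L¹` are equi-integrable and tight, so the gradients cannot concentrate.

By subtracting the limit and extending to the whole space it suffices to treat sequences `u n` that
tend weakly to zero in `W^{1,1}(ℝᵈ)`. Then `u n` and its gradient are weakly null in `L¹`, and by
`exists_forall_setLIntegral_enorm_le` (Vitali–Hahn–Saks, proved with Baire's theorem) they are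
uniformly absolutely continuous with respect to a finite measure equivalent to Lebesgue measure.
This one statement contains both equi-integrability and tightness. By the density of smooth
compactly supported functions (`exists_contDiff_integral_norm_sub_lt`) the `u n` may be taken
smooth.

* Averages over balls tend to zero pointwise by weak convergence, and are close to `u n` in `L¹`
  because the gradients are bounded
  (`tendsto_setLIntegral_enorm_of_tendsto_setIntegral_ball`). With tightness, `u n` tends to zero
  strongly in `L¹(ℝᵈ)`.
* The part of `u n` of height at most two is bounded in the critical space by a power of the `L¹`
  norm. The remaining part has its gradient supported in `{1 ≤ ‖u n‖}`, so by the
  Gagliardo–Nirenberg–Sobolev inequality it is controlled by the integral of the gradient over this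
  set (`exists_eLpNorm_le_add_setLIntegral_fderiv`). The measure of the set tends to zero, and
  equi-integrability of the gradients finishes the proof
  (`tendsto_eLpNorm_critExp_of_weaklyNullL1`).

Failure of compactness on any nonempty open set is shown by a rescaled bump function
(`IsSobolevEmbedding.not_isCompactOperator`). The whole space is itself an extension domain, with
the identity as extension operator.
-/

/-! ### Equi-integrability of weakly null sequences -/

section UniformAbsoluteContinuity

variable {α : Type*} [MeasurableSpace α] {μ ν : Measure α}

/-- Almost everywhere convergence along subsequences makes an integral against a fixed `L¹`
function continuous on the `L¹`-closed set of functions bounded by one. -/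
theorem tendsto_integral_mul_of_tendsto_Lp_one (hμν : μ ≪ ν) {f : α → ℝ} (hf : Integrable f μ)
    {φ : ℕ → Lp ℝ 1 ν} {ψ : Lp ℝ 1 ν} (hφ : ∀ n, ∀ᵐ x ∂ν, ‖φ n x‖ ≤ 1)
    (hlim : Tendsto φ atTop (𝓝 ψ)) :
    Tendsto (fun n => ∫ x, φ n x * f x ∂μ) atTop (𝓝 (∫ x, ψ x * f x ∂μ)) := by
  refine tendsto_of_subseq_tendsto fun ns hns => ?_
  have h1 : TendstoInMeasure ν (fun n => (φ (ns n) : α → ℝ)) atTop ψ :=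
    tendstoInMeasure_of_tendsto_Lp (hlim.comp hns)
  obtain ⟨ms, -, hae⟩ := h1.exists_seq_tendsto_ae
  refine ⟨ms, ?_⟩
  refine tendsto_integral_of_dominated_convergence (fun x => ‖f x‖) (fun n => ?_) hf.norm
    (fun n => ?_) ?_
  · exact ((Lp.aestronglyMeasurable (φ (ns (ms n)))).mono_ac hμν).mul hf.aestronglyMeasurable
  · filter_upwards [hμν.ae_le (hφ (ns (ms n)))] with x hx
    rw [norm_mul]
    exact mul_le_of_le_one_left (norm_nonneg _) hx
  · filter_upwards [hμν.ae_le hae] with x hx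
    exact hx.mul_const _

theorem isClosed_setOf_ae_norm_le_one_Lp_one :
    IsClosed {φ : Lp ℝ 1 ν | ∀ᵐ x ∂ν, ‖φ x‖ ≤ 1} := by
  refine IsSeqClosed.isClosed fun φ ψ hφ hlim => ?_
  obtain ⟨ms, -, hae⟩ := (tendstoInMeasure_of_tendsto_Lp hlim).exists_seq_tendsto_ae
  have hall : ∀ᵐ x ∂ν, ∀ n, ‖φ n x‖ ≤ 1 := ae_all_iff.2 hφ
  filter_upwards [hae, hall] with x hx hx'
  exact le_of_tendsto hx.norm (Eventually.of_forall fun n => hx' _)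

/-- **Vitali–Hahn–Saks** for densities: a sequence that tends to zero weakly in `L¹(μ)` is
uniformly absolutely continuous with respect to any finite measure dominating `μ`. The proof is
Baire's theorem on the complete metric space of functions bounded by one, with the distance of
`L¹(ν)`. -/
theorem exists_forall_setIntegral_norm_le [IsFiniteMeasure ν] (hμν : μ ≪ ν) {f : ℕ → α → ℝ}
    (hf : ∀ n, Integrable (f n) μ) (hm : ∀ n, StronglyMeasurable (f n))
    (hweak : ∀ φ : α → ℝ, AEStronglyMeasurable φ μ → (∀ᵐ x ∂μ, ‖φ x‖ ≤ 1) →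
      Tendsto (fun n => ∫ x, φ x * f n x ∂μ) atTop (𝓝 0)) {ε : ℝ} (hε : 0 < ε) :
    ∃ δ > 0, ∃ N, ∀ n ≥ N, ∀ A, MeasurableSet A → ν.real A ≤ δ → ∫ x in A, ‖f n x‖ ∂μ ≤ ε := by
  let K : Set (Lp ℝ 1 ν) := {φ | ∀ᵐ x ∂ν, ‖φ x‖ ≤ 1}
  have hK : IsClosed K := isClosed_setOf_ae_norm_le_one_Lp_one
  have : CompleteSpace K := hK.completeSpace_coe
  have : Nonempty K := by
    refine ⟨⟨0, ?_⟩⟩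
    filter_upwards [Lp.coeFn_zero ℝ 1 ν] with x hx
    rw [hx]; simp
  let S : ℕ → Set K := fun N => {φ | ∀ n ≥ N, |∫ x, (φ : Lp ℝ 1 ν) x * f n x ∂μ| ≤ ε / 2}
  have hS : ∀ N, IsClosed (S N) := by
    intro N
    refine IsSeqClosed.isClosed fun φ ψ hφ hlim n hn => ?_
    have h := tendsto_integral_mul_of_tendsto_Lp_one hμν (hf n)
      (φ := fun k => (φ k : Lp ℝ 1 ν)) (fun k => (φ k).2) (tendsto_subtype_rng.1 hlim)
    exact le_of_tendsto h.abs (Eventually.of_forall fun k => hφ k n hn)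
  have hU : ⋃ N, S N = Set.univ := by
    refine Set.eq_univ_of_forall fun φ => ?_
    have h := hweak (φ : Lp ℝ 1 ν) ((Lp.aestronglyMeasurable _).mono_ac hμν) (hμν.ae_le φ.2)
    have h' := (h.abs.eventually_le_const (u := ε / 2) (by simpa using half_pos hε))
    obtain ⟨N, hN⟩ := eventually_atTop.1 h'
    exact Set.mem_iUnion.2 ⟨N, hN⟩
  obtain ⟨N, φ₀, hφ₀⟩ := nonempty_interior_of_iUnion_of_closed hS hU
  obtain ⟨r, hr, hball⟩ := Metric.mem_nhds_iff.1 (mem_interior_iff_mem_nhds.1 hφ₀)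
  have hφ₀K : ∀ᵐ x ∂ν, ‖(φ₀ : Lp ℝ 1 ν) x‖ ≤ 1 := φ₀.2
  refine ⟨r / 4, by positivity, N, fun n hn A hA hAδ => ?_⟩
  -- Modifying `φ₀` on the small set `A` stays in the ball on which the integrals are small.
  have key : ∀ s : α → ℝ, StronglyMeasurable s → (∀ x, ‖s x‖ ≤ 1) →
      |∫ x, A.indicator s x * f n x ∂μ + ∫ x, Aᶜ.indicator (φ₀ : Lp ℝ 1 ν) x * f n x ∂μ|
        ≤ ε / 2 := by
    intro s hs hs1
    have hmeas : AEStronglyMeasurable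
        (fun x => A.indicator s x + Aᶜ.indicator (φ₀ : Lp ℝ 1 ν) x) ν :=
      (hs.indicator hA).aestronglyMeasurable.add
        ((Lp.aestronglyMeasurable _).indicator hA.compl)
    have hle : ∀ᵐ x ∂ν, ‖A.indicator s x + Aᶜ.indicator (φ₀ : Lp ℝ 1 ν) x‖ ≤ 1 := by
      filter_upwards [hφ₀K] with x hx
      by_cases hxA : x ∈ A
      · simpa [hxA] using hs1 x
      · simpa [hxA] using hx
    have hmem : MemLp (fun x => A.indicator s x + Aᶜ.indicator (φ₀ : Lp ℝ 1 ν) x) 1 ν :=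
      MemLp.of_bound hmeas 1 hle
    let ψ : Lp ℝ 1 ν := hmem.toLp _
    have hψ : ψ =ᵐ[ν] fun x => A.indicator s x + Aᶜ.indicator (φ₀ : Lp ℝ 1 ν) x :=
      hmem.coeFn_toLp
    have hψK : ψ ∈ K := by
      filter_upwards [hψ, hle] with x h1 h2
      rwa [h1]
    have hdist : dist (⟨ψ, hψK⟩ : K) φ₀ < r := by
      rw [Subtype.dist_eq, dist_eq_norm, L1.norm_eq_integral_norm]
      have hbd : ∀ᵐ x ∂ν, ‖(ψ - (φ₀ : Lp ℝ 1 ν) : Lp ℝ 1 ν) x‖ ≤ A.indicator (fun _ => 2) x := by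
        filter_upwards [hψ, Lp.coeFn_sub ψ (φ₀ : Lp ℝ 1 ν), hφ₀K] with x h1 h2 h3
        rw [h2, Pi.sub_apply, h1]
        by_cases hxA : x ∈ A
        · simp only [hxA, Set.indicator_of_mem, Set.mem_compl_iff, not_true, not_false_eq_true,
            Set.indicator_of_notMem, add_zero]
          have := norm_sub_le (s x) ((φ₀ : Lp ℝ 1 ν) x)
          linarith [hs1 x]
        · simp [hxA]
      have hint : ∫ x, A.indicator (fun _ => (2 : ℝ)) x ∂ν = ν.real A * 2 := by
        rw [integral_indicator hA, setIntegral_const, smul_eq_mul]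
      have := integral_mono_ae (L1.integrable_coeFn (ψ - (φ₀ : Lp ℝ 1 ν))).norm
        ((integrable_const (2 : ℝ)).indicator hA) hbd
      rw [hint] at this
      linarith
    have hmemS := hball (Metric.mem_ball.2 hdist) n hn
    have heq : ∫ x, ψ x * f n x ∂μ =
        ∫ x, A.indicator s x * f n x ∂μ + ∫ x, Aᶜ.indicator (φ₀ : Lp ℝ 1 ν) x * f n x ∂μ := by
      rw [← integral_add]
      · refine integral_congr_ae ?_
        filter_upwards [hμν.ae_le hψ] with x hx
        rw [hx, add_mul]
      · refine (hf n).bdd_mul (c := 1) (hs.indicator hA).aestronglyMeasurable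
          (.of_forall fun x => ?_)
        exact (norm_indicator_le_norm_self _ _).trans (hs1 x)
      · refine (hf n).bdd_mul (c := 1)
          (((Lp.aestronglyMeasurable _).indicator hA.compl).mono_ac hμν) ?_
        filter_upwards [hμν.ae_le hφ₀K] with x hx
        exact (norm_indicator_le_norm_self _ _).trans hx
    rw [← heq]
    exact hmemS
  have hset : MeasurableSet {x | 0 ≤ f n x} := (hm n).measurable measurableSet_Ici
  -- Compare the sign of `f n` on `A` with zero on `A`; the part outside `A` cancels.
  have k1 := key (fun x => if 0 ≤ f n x then 1 else -1)
    (StronglyMeasurable.ite hset stronglyMeasurable_const stronglyMeasurable_const)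
    (fun x => by split_ifs <;> simp)
  have k2 := key 0 stronglyMeasurable_zero (by simp)
  have e1 : ∫ x, A.indicator (fun x => if 0 ≤ f n x then (1 : ℝ) else -1) x * f n x ∂μ =
      ∫ x in A, ‖f n x‖ ∂μ := by
    rw [← integral_indicator hA]
    refine integral_congr_ae (.of_forall fun x => ?_)
    by_cases hxA : x ∈ A
    · by_cases h0 : 0 ≤ f n x
      · simp [hxA, h0, abs_of_nonneg]
      · simp [hxA, h0, abs_of_neg (not_le.1 h0)]
    · simp [hxA]
  rw [e1] at k1
  simp only [Set.indicator_zero', Pi.zero_apply, zero_mul, integral_zero, zero_add] at k2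
  have := abs_le.1 k1
  have := abs_le.1 k2
  linarith

/-- Vector-valued version of `exists_forall_setIntegral_norm_le`, obtained from the coordinates. -/
theorem exists_forall_setLIntegral_enorm_le [IsFiniteMeasure ν] (hμν : μ ≪ ν)
    {F : Type*} [NormedAddCommGroup F] [NormedSpace ℝ F] [FiniteDimensional ℝ F] {f : ℕ → α → F}
    (hf : ∀ n, Integrable (f n) μ) (hm : ∀ n, StronglyMeasurable (f n))
    (hweak : ∀ (ℓ : F →L[ℝ] ℝ) (φ : α → ℝ), AEStronglyMeasurable φ μ → (∀ᵐ x ∂μ, ‖φ x‖ ≤ 1) →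
      Tendsto (fun n => ∫ x, φ x * ℓ (f n x) ∂μ) atTop (𝓝 0)) {ε : ℝ} (hε : 0 < ε) :
    ∃ δ > 0, ∃ N, ∀ n ≥ N, ∀ A, MeasurableSet A → ν.real A ≤ δ →
      ∫⁻ x in A, ‖f n x‖ₑ ∂μ ≤ ENNReal.ofReal ε := by
  let b := Module.finBasis ℝ F
  let ℓ : Fin (Module.finrank ℝ F) → F →L[ℝ] ℝ := fun i => (b.coord i).toContinuousLinearMap
  have hb : ∀ y : F, ‖y‖ ≤ ∑ i, ‖ℓ i y‖ * ‖b i‖ := by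
    intro y
    conv_lhs => rw [← b.sum_repr y]
    refine (norm_sum_le _ _).trans (Finset.sum_le_sum fun i _ => ?_)
    rw [norm_smul]
    rfl
  set D : ℝ := ∑ i, ‖b i‖ + 1 with hD
  have hDpos : 0 < D := by positivity
  have hs := fun i => exists_forall_setIntegral_norm_le hμν (f := fun n x => ℓ i (f n x))
    (fun n => (ℓ i).integrable_comp (hf n))
    (fun n => (ℓ i).continuous.comp_stronglyMeasurable (hm n)) (hweak (ℓ i))
    (ε := ε / D) (by positivity)
  choose δ hδ N hN using hs
  -- The finitely many coordinates have a common `δ`.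
  obtain ⟨δ₀, hδ₀, hδ₀le⟩ : ∃ δ₀ > 0, ∀ i, δ₀ ≤ δ i := by
    have h := (Finset.univ : Finset (Fin (Module.finrank ℝ F))).exists_min_image δ
    rcases (Finset.univ : Finset (Fin (Module.finrank ℝ F))).eq_empty_or_nonempty with he | hne
    · exact ⟨1, one_pos, fun i => absurd (Finset.mem_univ i) (by simp [he])⟩
    · obtain ⟨i, -, hi⟩ := h hne
      exact ⟨δ i, hδ i, fun j => hi j (Finset.mem_univ j)⟩
  refine ⟨δ₀, hδ₀, ∑ i, N i, fun n hn A hA hAδ => ?_⟩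
  have hn' : ∀ i, N i ≤ n := fun i =>
    (Finset.single_le_sum (fun _ _ => Nat.zero_le _) (Finset.mem_univ i)).trans hn
  rw [← ofReal_integral_norm_eq_lintegral_enorm (hf n).integrableOn]
  refine ENNReal.ofReal_le_ofReal ?_
  have hint : ∀ i ∈ (Finset.univ : Finset (Fin (Module.finrank ℝ F))),
      Integrable (fun x => ‖ℓ i (f n x)‖ * ‖b i‖) (μ.restrict A) := fun i _ =>
    (((ℓ i).integrable_comp (hf n)).integrableOn.norm).mul_const _
  calc ∫ x in A, ‖f n x‖ ∂μ ≤ ∫ x in A, ∑ i, ‖ℓ i (f n x)‖ * ‖b i‖ ∂μ :=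
        integral_mono (hf n).integrableOn.norm (integrable_finsetSum _ hint) fun x => hb _
    _ = ∑ i, (∫ x in A, ‖ℓ i (f n x)‖ ∂μ) * ‖b i‖ := by
        rw [integral_finsetSum _ hint]
        simp_rw [integral_mul_const]
    _ ≤ ∑ i, ε / D * ‖b i‖ := Finset.sum_le_sum fun i _ =>
        mul_le_mul_of_nonneg_right (hN i n (hn' i) A hA (hAδ.trans (hδ₀le i))) (norm_nonneg _)
    _ = ε / D * (D - 1) := by rw [← Finset.mul_sum, hD]; ring
    _ ≤ ε / D * D := by gcongr; linarith
    _ = ε := by field_simp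

end UniformAbsoluteContinuity

/-! ### Density of smooth compactly supported functions -/

section Density

theorem ContDiff.integrable_fderiv_of_hasCompactSupport
    {E F : Type*} [NormedAddCommGroup E] [NormedSpace ℝ E] [MeasurableSpace E] [BorelSpace E]
    {μ : Measure E} [IsFiniteMeasureOnCompacts μ] [NormedAddCommGroup F] [NormedSpace ℝ F]
    {u : E → F}
    (hu : ContDiff ℝ 1 u) (hc : HasCompactSupport u) : Integrable (fderiv ℝ u) μ :=
  (hu.continuous_fderiv one_ne_zero).integrable_of_hasCompactSupport (hc.fderiv (𝕜 := ℝ))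

/-- **Scheffé's lemma** for vector-valued functions: almost everywhere convergence without excess
of mass implies convergence in `L¹`. -/
theorem tendsto_integral_norm_sub_of_ae_tendsto_of_le {α : Type*} [MeasurableSpace α]
    {μ : Measure α} {F : Type*} [NormedAddCommGroup F] {f : ℕ → α → F} {g : α → F}
    (hf : ∀ n, Integrable (f n) μ) (hg : Integrable g μ)
    (hae : ∀ᵐ x ∂μ, Tendsto (fun n => f n x) atTop (𝓝 (g x)))
    (hle : ∀ n, ∫ x, ‖f n x‖ ∂μ ≤ ∫ x, ‖g x‖ ∂μ) :
    Tendsto (fun n => ∫ x, ‖f n x - g x‖ ∂μ) atTop (𝓝 0) := by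
  -- The functions `‖f n‖ + ‖g‖ - ‖f n - g‖` are dominated by `2 ‖g‖`, to which they converge.
  have hk : Tendsto (fun n => ∫ x, (‖f n x‖ + ‖g x‖ - ‖f n x - g x‖) ∂μ) atTop
      (𝓝 (∫ x, (‖g x‖ + ‖g x‖ - ‖g x - g x‖) ∂μ)) := by
    refine tendsto_integral_of_dominated_convergence (fun x => 2 * ‖g x‖)
      (fun n => (((hf n).norm.add hg.norm).sub ((hf n).sub hg).norm).aestronglyMeasurable)
      (hg.norm.const_mul 2) (fun n => .of_forall fun x => ?_) ?_
    · have h1 := norm_sub_le (f n x) (g x)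
      have h2 := norm_add_le (f n x - g x) (g x)
      rw [sub_add_cancel] at h2
      rw [Real.norm_eq_abs, abs_of_nonneg (by linarith)]
      linarith
    · filter_upwards [hae] with x hx
      exact (hx.norm.add_const _).sub (hx.sub_const _).norm
  have h0 : ∫ x, (‖g x‖ + ‖g x‖ - ‖g x - g x‖) ∂μ = 2 * ∫ x, ‖g x‖ ∂μ := by
    rw [← integral_const_mul]
    refine integral_congr_ae (.of_forall fun x => ?_)
    simp only [sub_self, norm_zero]
    ring
  rw [h0] at hk
  have hlim : Tendsto (fun n => 2 * ∫ x, ‖g x‖ ∂μ -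
      ∫ x, (‖f n x‖ + ‖g x‖ - ‖f n x - g x‖) ∂μ) atTop (𝓝 0) := by
    simpa using hk.const_sub (2 * ∫ x, ‖g x‖ ∂μ)
  refine squeeze_zero (fun n => integral_nonneg fun x => norm_nonneg _) (fun n => ?_) hlim
  have e : ∫ x, (‖f n x‖ + ‖g x‖ - ‖f n x - g x‖) ∂μ =
      ∫ x, ‖f n x‖ ∂μ + ∫ x, ‖g x‖ ∂μ - ∫ x, ‖f n x - g x‖ ∂μ := by
    have h1 := integral_sub ((hf n).norm.add hg.norm) ((hf n).sub hg).norm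
    have h2 := integral_add (hf n).norm hg.norm
    simp only [Pi.add_apply, Pi.sub_apply] at h1 h2
    rw [h1, h2]
  rw [e]
  linarith [hle n]

variable {E : Type*} [NormedAddCommGroup E] [NormedSpace ℝ E] [FiniteDimensional ℝ E]
  [MeasurableSpace E] [BorelSpace E] {μ : Measure E}
  {F : Type*} [NormedAddCommGroup F] [NormedSpace ℝ F]

theorem ContDiffBump.integrable_normed_convolution [μ.IsAddHaarMeasure]
    (φ : ContDiffBump (0 : E)) {f : E → F} (hf : Integrable f μ) :
    Integrable (convolution (φ.normed μ) f (ContinuousLinearMap.lsmul ℝ ℝ) μ) μ :=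
  φ.integrable_normed.integrable_convolution _ hf

theorem ContDiffBump.integral_norm_normed_convolution_le [μ.IsAddHaarMeasure]
    (φ : ContDiffBump (0 : E)) {f : E → F} (hf : Integrable f μ) :
    ∫ x, ‖convolution (φ.normed μ) f (ContinuousLinearMap.lsmul ℝ ℝ) μ x‖ ∂μ ≤
      ∫ x, ‖f x‖ ∂μ := by
  have h : ∫ x, convolution (φ.normed μ) (fun x => ‖f x‖) (ContinuousLinearMap.lsmul ℝ ℝ) μ x ∂μ =
      ∫ x, ‖f x‖ ∂μ := by
    rw [integral_convolution _ φ.integrable_normed hf.norm, φ.integral_normed]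
    simp
  rw [← h]
  refine integral_mono (φ.integrable_normed_convolution hf).norm
    (φ.integrable_normed_convolution hf.norm) fun x => ?_
  simp only [convolution_def]
  refine (norm_integral_le_integral_norm _).trans (le_of_eq ?_)
  refine integral_congr_ae (.of_forall fun t => ?_)
  simp [norm_smul, abs_of_nonneg (φ.nonneg_normed (μ := μ) t)]

/-- The standard mollifiers: bump functions supported in balls of radius `2 / (n + 1)`. -/
noncomputable def mollifier (E : Type*) [NormedAddCommGroup E] [NormedSpace ℝ E] (n : ℕ) :
    ContDiffBump (0 : E) where
  rIn := 1 / ((n : ℝ) + 1)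
  rOut := 2 / ((n : ℝ) + 1)
  rIn_pos := by positivity
  rIn_lt_rOut := by gcongr; norm_num

theorem tendsto_integral_norm_mollifier_convolution_sub [μ.IsAddHaarMeasure] [CompleteSpace F]
    {f : E → F} (hf : Integrable f μ) :
    Tendsto (fun n => ∫ x, ‖convolution ((mollifier E n).normed μ) f
      (ContinuousLinearMap.lsmul ℝ ℝ) μ x - f x‖ ∂μ) atTop (𝓝 0) := by
  refine tendsto_integral_norm_sub_of_ae_tendsto_of_le
    (fun n => (mollifier E n).integrable_normed_convolution hf) hf ?_
    (fun n => (mollifier E n).integral_norm_normed_convolution_le hf)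
  refine ContDiffBump.ae_convolution_tendsto_right_of_locallyIntegrable (K := 2) ?_
    (.of_forall fun n => ?_) hf.locallyIntegrable
  · simpa [mollifier, div_eq_mul_inv] using
      (tendsto_one_div_add_atTop_nhds_zero_nat (𝕜 := ℝ)).const_mul 2
  · simp only [mollifier]
    apply le_of_eq
    ring

variable (μ) in
/-- Cutting off at infinity: `χ (x / (n + 1)) • v x` converges to `v` together with its gradient,
for a fixed bump function `χ`. -/
theorem exists_hasCompactSupport_integral_norm_sub_lt {v : E → F} (hv : ContDiff ℝ 1 v)
    (hvi : Integrable v μ) (hdv : Integrable (fderiv ℝ v) μ) {ε : ℝ} (hε : 0 < ε) :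
    ∃ w : E → F, ContDiff ℝ 1 w ∧ HasCompactSupport w ∧ ∫ x, ‖w x - v x‖ ∂μ < ε ∧
      ∫ x, ‖fderiv ℝ w x - fderiv ℝ v x‖ ∂μ < ε := by
  let χ : ContDiffBump (0 : E) := ⟨1, 2, one_pos, one_lt_two⟩
  let c : ℕ → ℝ := fun n => 1 / ((n : ℝ) + 1)
  have hc0 : ∀ n, 0 < c n := fun n => by positivity
  have hc1 : ∀ n, c n ≤ 1 := fun n => by
    rw [div_le_one (by positivity)]
    linarith [Nat.cast_nonneg (α := ℝ) n]
  have hclim : Tendsto c atTop (𝓝 0) := tendsto_one_div_add_atTop_nhds_zero_nat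
  let w : ℕ → E → F := fun n x => χ (c n • x) • v x
  have hw : ∀ n, ContDiff ℝ 1 (w n) := fun n =>
    (χ.contDiff.comp (contDiff_const_smul (c n))).smul hv
  have hχc : ContDiff ℝ 1 χ := χ.contDiff
  obtain ⟨C, hC⟩ := (χ.hasCompactSupport.fderiv (𝕜 := ℝ)).exists_bound_of_continuous
    (hχc.continuous_fderiv one_ne_zero)
  -- Near every point the cut-off is eventually inactive.
  have hev : ∀ x, ∀ᶠ n in atTop, w n =ᶠ[𝓝 x] v := by
    intro x
    have h1 : Tendsto (fun n => c n * (‖x‖ + 1)) atTop (𝓝 0) := by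
      simpa using hclim.mul_const (‖x‖ + 1)
    filter_upwards [h1.eventually_lt_const one_pos] with n hn
    filter_upwards [Metric.ball_mem_nhds x one_pos] with y hy
    have hy' : ‖y‖ ≤ ‖x‖ + 1 := by
      have := norm_le_norm_add_norm_sub' y x
      rw [mem_ball_iff_norm] at hy
      linarith
    have : χ (c n • y) = 1 := by
      apply χ.one_of_mem_closedBall
      rw [mem_closedBall_zero_iff, norm_smul, Real.norm_eq_abs, abs_of_pos (hc0 n)]
      exact (mul_le_mul_of_nonneg_left hy' (hc0 n).le).trans hn.le
    simp [w, this]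
  have hder : ∀ n x, fderiv ℝ (w n) x = χ (c n • x) • fderiv ℝ v x +
      (c n • fderiv ℝ χ (c n • x)).smulRight (v x) := by
    intro n x
    have h1 : HasFDerivAt (fun y => χ (c n • y)) (c n • fderiv ℝ χ (c n • x)) x := by
      have h2 : HasFDerivAt (fun y => χ (c n • y))
          ((fderiv ℝ χ (c n • x)).comp (c n • ContinuousLinearMap.id ℝ E)) x :=
        ((hχc.differentiable one_ne_zero) (c n • x)).hasFDerivAt.comp x
          ((hasFDerivAt_id x).const_smul (c n))
      rwa [ContinuousLinearMap.comp_smul, ContinuousLinearMap.comp_id] at h2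
    exact (h1.smul ((hv.differentiable one_ne_zero) x).hasFDerivAt).fderiv
  have hχle : ∀ y, |χ y| ≤ 1 := fun y => by
    rw [abs_of_nonneg χ.nonneg]
    exact χ.le_one
  have hA : Tendsto (fun n => ∫ x, ‖w n x - v x‖ ∂μ) atTop (𝓝 (∫ _, (0 : ℝ) ∂μ)) := by
    refine tendsto_integral_of_dominated_convergence (fun x => 2 * ‖v x‖)
      (fun n => ((hw n).continuous.sub hv.continuous).norm.aestronglyMeasurable)
      (hvi.norm.const_mul 2) (fun n => .of_forall fun x => ?_) (.of_forall fun x => ?_)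
    · rw [norm_norm]
      refine (norm_sub_le _ _).trans ?_
      have : ‖w n x‖ ≤ ‖v x‖ := by
        simp only [w, norm_smul, Real.norm_eq_abs]
        exact mul_le_of_le_one_left (norm_nonneg _) (hχle _)
      linarith
    · refine tendsto_const_nhds.congr' ?_
      filter_upwards [hev x] with n hn
      simp [hn.eq_of_nhds]
  have hB : Tendsto (fun n => ∫ x, ‖fderiv ℝ (w n) x - fderiv ℝ v x‖ ∂μ) atTop
      (𝓝 (∫ _, (0 : ℝ) ∂μ)) := by
    refine tendsto_integral_of_dominated_convergence (fun x => 2 * ‖fderiv ℝ v x‖ + C * ‖v x‖)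
      (fun n => (((hw n).continuous_fderiv one_ne_zero).sub
        (hv.continuous_fderiv one_ne_zero)).norm.aestronglyMeasurable)
      ((hdv.norm.const_mul 2).add (hvi.norm.const_mul C))
      (fun n => .of_forall fun x => ?_) (.of_forall fun x => ?_)
    · rw [norm_norm, hder]
      refine (norm_sub_le _ _).trans ?_
      have h1 : ‖χ (c n • x) • fderiv ℝ v x‖ ≤ ‖fderiv ℝ v x‖ := by
        rw [norm_smul]
        exact mul_le_of_le_one_left (norm_nonneg _) (hχle _)
      have h2 : ‖(c n • fderiv ℝ χ (c n • x)).smulRight (v x)‖ ≤ C * ‖v x‖ := by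
        rw [ContinuousLinearMap.norm_smulRight_apply, norm_smul, Real.norm_eq_abs,
          abs_of_pos (hc0 n)]
        gcongr
        exact (mul_le_of_le_one_left (norm_nonneg _) (hc1 n)).trans (hC _)
      have h3 := norm_add_le (χ (c n • x) • fderiv ℝ v x)
        ((c n • fderiv ℝ χ (c n • x)).smulRight (v x))
      linarith
    · refine tendsto_const_nhds.congr' ?_
      filter_upwards [hev x] with n hn
      simp [hn.fderiv_eq]
  rw [integral_zero] at hA hB
  obtain ⟨n, h1, h2⟩ := ((hA.eventually_lt_const hε).and (hB.eventually_lt_const hε)).exists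
  refine ⟨w n, hw n, ?_, h1, h2⟩
  exact (χ.hasCompactSupport.comp_homeomorph (Homeomorph.smulOfNeZero (c n) (hc0 n).ne')).smul_right

end Density

section WeakDerivative

variable {d m : ℕ}

/-- Mollification commutes with the weak derivative. -/
theorem fderiv_mollifier_convolution
    {u : EuclideanSpace ℝ (Fin d) → EuclideanSpace ℝ (Fin m)}
    {G : EuclideanSpace ℝ (Fin d) → (EuclideanSpace ℝ (Fin d) →L[ℝ] EuclideanSpace ℝ (Fin m))}
    (hu : Integrable u) (hG : Integrable G) (h : HasWeakFDerivOn Set.univ u G)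
    (φ : ContDiffBump (0 : EuclideanSpace ℝ (Fin d))) (x : EuclideanSpace ℝ (Fin d)) :
    fderiv ℝ (convolution (φ.normed volume) u (ContinuousLinearMap.lsmul ℝ ℝ) volume) x =
      convolution (φ.normed volume) G (ContinuousLinearMap.lsmul ℝ ℝ) volume x := by
  have hφ : ContDiff ℝ 1 (φ.normed volume) := φ.contDiff_normed
  rw [(φ.hasCompactSupport_normed.hasFDerivAt_convolution_left (ContinuousLinearMap.lsmul ℝ ℝ)
    hφ hu.locallyIntegrable x).fderiv]
  ext1 v
  have hex1 : ConvolutionExistsAt (fderiv ℝ (φ.normed volume)) u x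
      ((ContinuousLinearMap.lsmul ℝ ℝ).precompL (EuclideanSpace ℝ (Fin d))) volume :=
    (φ.hasCompactSupport_normed.fderiv (𝕜 := ℝ)).convolutionExists_left _
      (hφ.continuous_fderiv one_ne_zero) hu.locallyIntegrable x
  have hex2 : ConvolutionExistsAt (φ.normed volume) G x (ContinuousLinearMap.lsmul ℝ ℝ) volume :=
    φ.hasCompactSupport_normed.convolutionExists_left _ hφ.continuous hG.locallyIntegrable x
  rw [convolution_eq_swap, convolution_eq_swap,
    ContinuousLinearMap.integral_apply hex1.integrable_swap,
    ContinuousLinearMap.integral_apply hex2.integrable_swap]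
  -- The weak derivative is tested against the reflected and translated mollifier.
  have ht := h (fun t => φ.normed volume (x - t))
    (φ.contDiff_normed.comp (contDiff_const.sub contDiff_id))
    (φ.hasCompactSupport_normed.comp_homeomorph (Homeomorph.subLeft x)) (Set.subset_univ _) v
  have hd : ∀ t, fderiv ℝ (fun t => φ.normed volume (x - t)) t v =
      - (fderiv ℝ (φ.normed volume) (x - t) v) := by
    intro t
    have h1 : HasFDerivAt (fun t => φ.normed volume (x - t)) _ t :=
      ((hφ.differentiable one_ne_zero) (x - t)).hasFDerivAt.comp t
        ((hasFDerivAt_id t).const_sub x)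
    rw [h1.fderiv]
    simp
  simp only [hd, neg_smul, integral_neg, neg_inj, Measure.restrict_univ] at ht
  simpa using ht

/-- `C¹` functions with compact support are dense in `W^{1,1}(ℝᵈ, ℝᵐ)`. -/
theorem exists_contDiff_integral_norm_sub_lt
    {u : EuclideanSpace ℝ (Fin d) → EuclideanSpace ℝ (Fin m)}
    {G : EuclideanSpace ℝ (Fin d) → (EuclideanSpace ℝ (Fin d) →L[ℝ] EuclideanSpace ℝ (Fin m))}
    (hu : Integrable u) (hG : Integrable G) (h : HasWeakFDerivOn Set.univ u G)
    {ε : ℝ} (hε : 0 < ε) :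
    ∃ w : EuclideanSpace ℝ (Fin d) → EuclideanSpace ℝ (Fin m), ContDiff ℝ 1 w ∧
      HasCompactSupport w ∧ ∫ x, ‖w x - u x‖ < ε ∧ ∫ x, ‖fderiv ℝ w x - G x‖ < ε := by
  obtain ⟨n, h1, h2⟩ := (((tendsto_integral_norm_mollifier_convolution_sub hu).eventually_lt_const
    (half_pos hε)).and ((tendsto_integral_norm_mollifier_convolution_sub hG).eventually_lt_const
    (half_pos hε))).exists
  set ρ := mollifier (EuclideanSpace ℝ (Fin d)) n
  set v := convolution (ρ.normed volume) u (ContinuousLinearMap.lsmul ℝ ℝ) volume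
  have hv : ContDiff ℝ 1 v := ρ.hasCompactSupport_normed.contDiff_convolution_left _
    ρ.contDiff_normed hu.locallyIntegrable
  have hvi : Integrable v := ρ.integrable_normed_convolution hu
  have hdv : fderiv ℝ v = convolution (ρ.normed volume) G (ContinuousLinearMap.lsmul ℝ ℝ) volume :=
    funext fun x => fderiv_mollifier_convolution hu hG h ρ x
  have hdvi : Integrable (fderiv ℝ v) := by
    rw [hdv]
    exact ρ.integrable_normed_convolution hG
  rw [← hdv] at h2
  obtain ⟨w, hw, hwc, h3, h4⟩ := exists_hasCompactSupport_integral_norm_sub_lt volume hv hvi hdvi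
    (half_pos hε)
  have hwi : Integrable w := hw.continuous.integrable_of_hasCompactSupport hwc
  have hdwi : Integrable (fderiv ℝ w) :=
    hw.integrable_fderiv_of_hasCompactSupport hwc
  refine ⟨w, hw, hwc, ?_, ?_⟩
  · have := integral_mono ((hwi.sub hu).norm) ((hwi.sub hvi).norm.add (hvi.sub hu).norm)
      fun x => norm_sub_le_norm_sub_add_norm_sub (w x) (v x) (u x)
    simp only [Pi.add_apply] at this
    rw [integral_add (hwi.sub hvi).norm (hvi.sub hu).norm] at this
    simp only [Pi.sub_apply] at this
    linarith
  · have := integral_mono ((hdwi.sub hG).norm) ((hdwi.sub hdvi).norm.add (hdvi.sub hG).norm)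
      fun x => norm_sub_le_norm_sub_add_norm_sub (fderiv ℝ w x) (fderiv ℝ v x) (G x)
    simp only [Pi.add_apply] at this
    rw [integral_add (hdwi.sub hdvi).norm (hdvi.sub hG).norm] at this
    simp only [Pi.sub_apply] at this
    linarith

end WeakDerivative

/-! ### Inequalities for smooth compactly supported functions -/

section SmoothInequalities

variable {E : Type*} [NormedAddCommGroup E] [NormedSpace ℝ E]
  {F : Type*} [NormedAddCommGroup F] [NormedSpace ℝ F] [FiniteDimensional ℝ F]

theorem enorm_add_sub_le_lintegral_fderiv {u : E → F} (hu : ContDiff ℝ 1 u) (x t : E) :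
    ‖u (x + t) - u x‖ₑ ≤ ∫⁻ s in Set.Ioc (0 : ℝ) 1, ‖fderiv ℝ u (x + s • t)‖ₑ * ‖t‖ₑ := by
  have : CompleteSpace F := FiniteDimensional.complete ℝ F
  have hd : ∀ s : ℝ, HasDerivAt (fun s : ℝ => u (x + s • t)) (fderiv ℝ u (x + s • t) t) s := by
    intro s
    have h1 : HasDerivAt (fun s : ℝ => x + s • t) t s := by
      simpa using ((hasDerivAt_id s).smul_const t).const_add x
    exact ((hu.differentiable one_ne_zero) _).hasFDerivAt.comp_hasDerivAt s h1
  have hc : Continuous fun s : ℝ => fderiv ℝ u (x + s • t) t :=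
    ((hu.continuous_fderiv one_ne_zero).comp (by fun_prop)).clm_apply continuous_const
  have h := intervalIntegral.integral_eq_sub_of_hasDerivAt (a := 0) (b := 1)
    (fun s _ => hd s) (hc.intervalIntegrable 0 1)
  simp only [one_smul, zero_smul, add_zero] at h
  rw [← h, intervalIntegral.integral_of_le zero_le_one]
  refine (enorm_integral_le_lintegral_enorm _).trans (lintegral_mono fun s => ?_)
  exact ContinuousLinearMap.le_opENorm _ _

variable [FiniteDimensional ℝ E] [MeasurableSpace E] [BorelSpace E]
  (μ : Measure E) [μ.IsAddHaarMeasure]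

theorem lintegral_enorm_add_sub_le {u : E → F} (hu : ContDiff ℝ 1 u) (t : E) :
    ∫⁻ x, ‖u (x + t) - u x‖ₑ ∂μ ≤ ‖t‖ₑ * ∫⁻ x, ‖fderiv ℝ u x‖ₑ ∂μ := by
  have hc : Continuous (fderiv ℝ u) := hu.continuous_fderiv one_ne_zero
  have hm : Measurable fun z : E × ℝ => ‖fderiv ℝ u (z.1 + z.2 • t)‖ₑ * ‖t‖ₑ :=
    (hc.comp (by fun_prop)).enorm.measurable.mul_const _
  calc ∫⁻ x, ‖u (x + t) - u x‖ₑ ∂μ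
      ≤ ∫⁻ x, (∫⁻ s in Set.Ioc (0 : ℝ) 1, ‖fderiv ℝ u (x + s • t)‖ₑ * ‖t‖ₑ) ∂μ :=
        lintegral_mono fun x => enorm_add_sub_le_lintegral_fderiv hu x t
    _ = ∫⁻ s in Set.Ioc (0 : ℝ) 1, ∫⁻ x, ‖fderiv ℝ u (x + s • t)‖ₑ * ‖t‖ₑ ∂μ :=
        lintegral_lintegral_swap hm.aemeasurable
    _ = ∫⁻ _ in Set.Ioc (0 : ℝ) 1, (∫⁻ x, ‖fderiv ℝ u x‖ₑ ∂μ) * ‖t‖ₑ := by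
        refine lintegral_congr fun s => ?_
        rw [lintegral_mul_const' _ _ (by simp),
          lintegral_add_right_eq_self (fun x => ‖fderiv ℝ u x‖ₑ) (s • t)]
    _ = ‖t‖ₑ * ∫⁻ x, ‖fderiv ℝ u x‖ₑ ∂μ := by
        simp [mul_comm]

/-- In `L¹`, a function differs from its averages over balls of radius `r` by at most `r` times
its gradient. The inequality is multiplied by the volume of the ball. -/
theorem lintegral_enorm_smul_sub_setIntegral_ball_le {u : E → F} (hu : ContDiff ℝ 1 u) (r : ℝ) :
    ∫⁻ x, ‖μ.real (Metric.ball 0 r) • u x - ∫ t in Metric.ball 0 r, u (x + t) ∂μ‖ₑ ∂μ ≤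
      μ (Metric.ball 0 r) * (ENNReal.ofReal r * ∫⁻ x, ‖fderiv ℝ u x‖ₑ ∂μ) := by
  have : CompleteSpace F := FiniteDimensional.complete ℝ F
  have hfin : μ (Metric.ball (0 : E) r) ≠ ⊤ := measure_ball_lt_top.ne
  have hm : Measurable fun z : E × E => ‖u (z.1 + z.2) - u z.1‖ₑ :=
    (((hu.continuous.comp (by fun_prop)).sub (hu.continuous.comp continuous_fst)).enorm).measurable
  have hp : ∀ x, ‖μ.real (Metric.ball 0 r) • u x - ∫ t in Metric.ball 0 r, u (x + t) ∂μ‖ₑ ≤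
      ∫⁻ t in Metric.ball 0 r, ‖u (x + t) - u x‖ₑ ∂μ := by
    intro x
    have hi : IntegrableOn (fun t => u (x + t)) (Metric.ball 0 r) μ :=
      ((hu.continuous.comp (by fun_prop)).continuousOn.integrableOn_compact
        (isCompact_closedBall 0 r)).mono_set Metric.ball_subset_closedBall
    have hconst : IntegrableOn (fun _ : E => u x) (Metric.ball 0 r) μ := integrableOn_const hfin
    have h1 : ∫ t in Metric.ball 0 r, (u (x + t) - u x) ∂μ =
        ∫ t in Metric.ball 0 r, u (x + t) ∂μ - μ.real (Metric.ball 0 r) • u x := by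
      rw [integral_sub hi hconst, setIntegral_const]
    rw [enorm_sub_rev, ← h1]
    exact enorm_integral_le_lintegral_enorm _
  calc _ ≤ ∫⁻ x, ∫⁻ t in Metric.ball 0 r, ‖u (x + t) - u x‖ₑ ∂μ ∂μ := lintegral_mono hp
    _ = ∫⁻ t in Metric.ball 0 r, ∫⁻ x, ‖u (x + t) - u x‖ₑ ∂μ ∂μ :=
        lintegral_lintegral_swap hm.aemeasurable
    _ ≤ ∫⁻ _ in Metric.ball 0 r, ENNReal.ofReal r * ∫⁻ x, ‖fderiv ℝ u x‖ₑ ∂μ ∂μ := by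
        refine setLIntegral_mono measurable_const fun t ht => ?_
        refine (lintegral_enorm_add_sub_le μ hu t).trans ?_
        gcongr
        rw [← ofReal_norm]
        exact ENNReal.ofReal_le_ofReal (mem_ball_zero_iff.1 ht).le
    _ = _ := by
        rw [setLIntegral_const, mul_comm]

/-- Splitting `u` into a bounded part and the part where `1 ≤ ‖u‖`: the first is controlled in
`Lᵖ` by the `L¹` norm, and the second by the Gagliardo–Nirenberg–Sobolev inequality, where only
the gradient on `{1 ≤ ‖u‖}` enters. -/
theorem exists_eLpNorm_le_add_setLIntegral_fderiv {p : NNReal}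
    (hp : NNReal.HolderConjugate (Module.finrank ℝ E) p) :
    ∃ C : NNReal, ∀ u : E → F, ContDiff ℝ 1 u → HasCompactSupport u →
      eLpNorm u p μ ≤ (2 ^ ((p : ℝ) - 1) * ∫⁻ x, ‖u x‖ₑ ∂μ) ^ (1 / (p : ℝ)) +
        C * ∫⁻ x in {x | 1 ≤ ‖u x‖}, ‖fderiv ℝ u x‖ₑ ∂μ := by
  have hp1 : (1 : ℝ) < p := by exact_mod_cast hp.symm.lt
  let χ : ContDiffBump (0 : F) := ⟨1, 2, one_pos, one_lt_two⟩
  have hχ : ContDiff ℝ 1 χ := χ.contDiff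
  let b : F → F := fun y => χ y • y
  have hb : ContDiff ℝ 1 b := hχ.smul contDiff_id
  have hbc : HasCompactSupport b := χ.hasCompactSupport.smul_right
  -- `Φ` vanishes on the unit ball and is the identity away from the ball of radius two.
  let Φ : F → F := fun y => y - b y
  have hΦ : ContDiff ℝ 1 Φ := contDiff_id.sub hb
  have hΦ0 : Φ 0 = 0 := by simp [Φ, b]
  obtain ⟨K, hK⟩ := (hbc.fderiv (𝕜 := ℝ)).exists_bound_of_continuous
    (hb.continuous_fderiv one_ne_zero)
  lift K to NNReal using (norm_nonneg _).trans (hK 0)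
  have hdΦ : ∀ y, ‖fderiv ℝ Φ y‖ ≤ 1 + K := by
    intro y
    have h1 : fderiv ℝ Φ y = ContinuousLinearMap.id ℝ F - fderiv ℝ b y := by
      have := (hasFDerivAt_id y).sub ((hb.differentiable one_ne_zero) y).hasFDerivAt
      exact this.fderiv
    rw [h1]
    exact (norm_sub_le _ _).trans (add_le_add ContinuousLinearMap.norm_id_le (hK y))
  have hdΦ0 : ∀ y, ‖y‖ < 1 → fderiv ℝ Φ y = 0 := by
    intro y hy
    have h1 : Φ =ᶠ[𝓝 y] fun _ => 0 := by
      filter_upwards [Metric.isOpen_ball.mem_nhds (mem_ball_zero_iff.2 hy)] with z hz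
      have : χ z = 1 := χ.one_of_mem_closedBall (Metric.ball_subset_closedBall hz)
      simp [Φ, b, this]
    rw [h1.fderiv_eq]
    simp
  have hbn : ∀ y, ‖b y‖ ≤ ‖y‖ := by
    intro y
    simp only [b, norm_smul, Real.norm_eq_abs, abs_of_nonneg χ.nonneg]
    exact mul_le_of_le_one_left (norm_nonneg _) χ.le_one
  have hb2 : ∀ y, ‖b y‖ ≤ 2 := by
    intro y
    by_cases hy : ‖y‖ < 2
    · exact (hbn y).trans hy.le
    · have : χ y = 0 := χ.zero_of_le_dist (by simpa using not_lt.1 hy)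
      simp [b, this]
  refine ⟨eLpNormLESNormFDerivOneConst μ p * (1 + K), fun u hu huc => ?_⟩
  have hmeas : MeasurableSet {x | 1 ≤ ‖u x‖} :=
    (isClosed_le continuous_const hu.continuous.norm).measurableSet
  have e : u = (fun x => b (u x)) + fun x => Φ (u x) := by
    ext1 x
    simp [Φ]
  conv_lhs => rw [e]
  refine (eLpNorm_add_le (hb.continuous.comp hu.continuous).aestronglyMeasurable
    (hΦ.continuous.comp hu.continuous).aestronglyMeasurable (by exact_mod_cast hp1.le)).trans ?_
  refine add_le_add ?_ ?_
  · rw [eLpNorm_nnreal_eq_lintegral (by rintro rfl; norm_num at hp1)]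
    gcongr
    rw [← lintegral_const_mul' _ _ (by finiteness)]
    refine lintegral_mono fun x => ?_
    have h2 : ‖b (u x)‖ₑ ≤ 2 := by
      rw [← ofReal_norm]
      exact (ENNReal.ofReal_le_ofReal (hb2 _)).trans (by simp)
    have h1 : ‖b (u x)‖ₑ ≤ ‖u x‖ₑ := by
      rw [← ofReal_norm, ← ofReal_norm]
      exact ENNReal.ofReal_le_ofReal (hbn _)
    calc ‖b (u x)‖ₑ ^ (p : ℝ) = ‖b (u x)‖ₑ ^ ((p : ℝ) - 1) * ‖b (u x)‖ₑ := by
          conv_rhs => rw [← ENNReal.rpow_one ‖b (u x)‖ₑ, ← ENNReal.rpow_mul, one_mul]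
          rw [← ENNReal.rpow_add_of_nonneg _ _ (by linarith) zero_le_one]
          congr 1
          ring
      _ ≤ 2 ^ ((p : ℝ) - 1) * ‖u x‖ₑ := by
          gcongr
  · have hcs : HasCompactSupport fun x => Φ (u x) := huc.comp_left hΦ0
    refine (eLpNorm_le_eLpNorm_fderiv_one μ (hΦ.comp hu) hcs hp).trans ?_
    rw [ENNReal.coe_mul, mul_assoc]
    gcongr
    rw [eLpNorm_one_eq_lintegral_enorm, ← lintegral_const_mul' _ _ (by finiteness),
      ← lintegral_indicator hmeas]
    refine lintegral_mono fun x => ?_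
    have hcomp : fderiv ℝ (fun x => Φ (u x)) x = (fderiv ℝ Φ (u x)).comp (fderiv ℝ u x) :=
      fderiv_comp x (hΦ.differentiable one_ne_zero _) (hu.differentiable one_ne_zero _)
    change ‖fderiv ℝ (fun x => Φ (u x)) x‖ₑ ≤ _
    rw [hcomp]
    by_cases hx : 1 ≤ ‖u x‖
    · rw [Set.indicator_of_mem (by exact hx)]
      have h := (ContinuousLinearMap.opNorm_comp_le (fderiv ℝ Φ (u x)) (fderiv ℝ u x)).trans
        (mul_le_mul_of_nonneg_right (hdΦ (u x)) (norm_nonneg _))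
      have h' := ENNReal.ofReal_le_ofReal h
      rw [ENNReal.ofReal_mul (by positivity), ofReal_norm, ofReal_norm] at h'
      refine h'.trans (le_of_eq ?_)
      rw [ENNReal.ofReal_add zero_le_one K.coe_nonneg, ENNReal.ofReal_one,
        ENNReal.ofReal_coe_nnreal]
      simp
    · have h0 : (fderiv ℝ Φ (u x)).comp (fderiv ℝ u x) = 0 := by
        rw [hdΦ0 _ (not_le.1 hx), ContinuousLinearMap.zero_comp]
      rw [h0, Set.indicator_of_notMem (by exact hx)]
      exact (enorm_zero (E := E →L[ℝ] F)).le

end SmoothInequalities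

/-! ### Weakly null sequences of integrable functions -/

section WeaklyNull

variable {α : Type*} [MeasurableSpace α] {μ : Measure α}
  {F : Type*} [NormedAddCommGroup F] [NormedSpace ℝ F]

/-- Weak convergence to zero in `L¹`, for a sequence of functions: the integrals against bounded
measurable functions with values in the dual of `F`, of rank one, tend to zero. -/
def WeaklyNullL1 (μ : Measure α) (f : ℕ → α → F) : Prop :=
  ∀ (ℓ : F →L[ℝ] ℝ) (φ : α → ℝ), AEStronglyMeasurable φ μ → (∀ᵐ x ∂μ, ‖φ x‖ ≤ 1) →
    Tendsto (fun n => ∫ x, φ x * ℓ (f n x) ∂μ) atTop (𝓝 0)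

theorem WeaklyNullL1.tendsto_setIntegral [FiniteDimensional ℝ F] {f : ℕ → α → F}
    (hf : ∀ n, Integrable (f n) μ) (h : WeaklyNullL1 μ f) {A : Set α} (hA : MeasurableSet A) :
    Tendsto (fun n => ∫ x in A, f n x ∂μ) atTop (𝓝 0) := by
  have : CompleteSpace F := FiniteDimensional.complete ℝ F
  let b := Module.finBasis ℝ F
  have hb : Tendsto (fun n => b.equivFunL (∫ x in A, f n x ∂μ)) atTop (𝓝 0) := by
    refine tendsto_pi_nhds.2 fun i => ?_
    let ℓ : F →L[ℝ] ℝ := (ContinuousLinearMap.proj (R := ℝ) i).comp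
      (b.equivFunL : F →L[ℝ] (Fin (Module.finrank ℝ F) → ℝ))
    have h1 := h ℓ (A.indicator fun _ => 1)
      ((stronglyMeasurable_const.indicator hA).aestronglyMeasurable)
      (.of_forall fun x => by by_cases hx : x ∈ A <;> simp [hx])
    refine h1.congr fun n => ?_
    have h2 : ∀ x, A.indicator (fun _ => (1 : ℝ)) x * ℓ (f n x) =
        A.indicator (fun x => ℓ (f n x)) x := fun x => by by_cases hx : x ∈ A <;> simp [hx]
    simp_rw [h2]
    rw [integral_indicator hA, ContinuousLinearMap.integral_comp_comm ℓ (hf n).integrableOn]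
    rfl
  have h3 := (b.equivFunL.symm.continuous.tendsto 0).comp hb
  rw [map_zero] at h3
  refine h3.congr fun n => ?_
  simp

/-- Integration against a bounded function composed with a functional, as a functional on `L¹`. -/
theorem exists_functional_eq_integral_mul {φ : α → ℝ} (hφ : AEStronglyMeasurable φ μ)
    (hφ1 : ∀ᵐ x ∂μ, ‖φ x‖ ≤ 1) (ℓ : F →L[ℝ] ℝ) :
    ∃ Λ : Lp F 1 μ →L[ℝ] ℝ, ∀ f : Lp F 1 μ, Λ f = ∫ x, φ x * ℓ (f x) ∂μ := by
  have hi : ∀ f : Lp F 1 μ, Integrable (fun x => φ x * ℓ (f x)) μ := fun f =>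
    (ℓ.integrable_comp (L1.integrable_coeFn f)).bdd_mul hφ hφ1
  let L : Lp F 1 μ →ₗ[ℝ] ℝ :=
    { toFun := fun f => ∫ x, φ x * ℓ (f x) ∂μ
      map_add' := fun f g => by
        rw [← integral_add (hi f) (hi g)]
        refine integral_congr_ae ?_
        filter_upwards [Lp.coeFn_add f g] with x hx
        rw [hx, Pi.add_apply, map_add, mul_add]
      map_smul' := fun c f => by
        rw [RingHom.id_apply, smul_eq_mul, ← integral_const_mul]
        refine integral_congr_ae ?_
        filter_upwards [Lp.coeFn_smul c f] with x hx
        rw [hx, Pi.smul_apply, map_smul, smul_eq_mul]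
        ring }
  refine ⟨L.mkContinuous ‖ℓ‖ fun f => ?_, fun f => rfl⟩
  rw [L1.norm_eq_integral_norm, ← integral_const_mul]
  refine (norm_integral_le_integral_norm _).trans ?_
  refine integral_mono_ae (hi f).norm ((L1.integrable_coeFn f).norm.const_mul _) ?_
  filter_upwards [hφ1] with x hx
  rw [norm_mul]
  exact (mul_le_of_le_one_left (norm_nonneg _) hx).trans (ℓ.le_opNorm _)

theorem WeaklyConverges.comp_clm {X Y : Type*} [NormedAddCommGroup X] [NormedSpace ℝ X]
    [NormedAddCommGroup Y] [NormedSpace ℝ Y] {x : ℕ → X} (h : WeaklyConverges x 0)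
    (T : X →L[ℝ] Y) : WeaklyConverges (fun n => T (x n)) 0 := by
  intro f
  simpa using h (f.comp T)

theorem WeaklyConverges.sub_const {X : Type*} [NormedAddCommGroup X] [NormedSpace ℝ X]
    {x : ℕ → X} {y : X} (h : WeaklyConverges x y) : WeaklyConverges (fun n => x n - y) 0 := by
  intro f
  simpa using (h f).sub_const (f y)

theorem WeaklyConverges.weaklyNullL1 {f : ℕ → Lp F 1 μ} (h : WeaklyConverges f 0) :
    WeaklyNullL1 μ fun n => f n := by
  intro ℓ φ hφ hφ1
  obtain ⟨Λ, hΛ⟩ := exists_functional_eq_integral_mul hφ hφ1 ℓ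
  have := h Λ
  rw [map_zero] at this
  exact this.congr fun n => hΛ _

/-- Weakly convergent sequences are bounded: the uniform boundedness principle in the bidual. -/
theorem WeaklyConverges.exists_norm_le {X : Type*} [NormedAddCommGroup X] [NormedSpace ℝ X]
    {x : ℕ → X} {y : X} (h : WeaklyConverges x y) : ∃ C, ∀ n, ‖x n‖ ≤ C := by
  obtain ⟨C, hC⟩ := banach_steinhaus
    (g := fun n => NormedSpace.inclusionInDoubleDual ℝ X (x n)) fun f => by
      obtain ⟨C, hC⟩ := (h f).norm.bddAbove_range
      exact ⟨C, fun n => hC ⟨n, rfl⟩⟩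
  refine ⟨C, fun n => ?_⟩
  rw [← (NormedSpace.inclusionInDoubleDualLi ℝ (E := X)).norm_map (x n)]
  exact hC n

end WeaklyNull

/-! ### Strong convergence in `L¹` -/

section StrongL1

variable {E : Type*} [NormedAddCommGroup E] [NormedSpace ℝ E] [FiniteDimensional ℝ E]
  [MeasurableSpace E] [BorelSpace E] (μ : Measure E) [μ.IsAddHaarMeasure]
  {F : Type*} [NormedAddCommGroup F] [NormedSpace ℝ F] [FiniteDimensional ℝ F]

/-- Local strong convergence: if all averages over balls tend to zero, then a sequence with bounded
gradients tends to zero in `L¹` on sets of finite measure. -/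
theorem tendsto_setLIntegral_enorm_of_tendsto_setIntegral_ball {w : ℕ → E → F}
    (hw : ∀ n, ContDiff ℝ 1 (w n)) {C : NNReal} (hC : ∀ n, ∫⁻ x, ‖w n x‖ₑ ∂μ ≤ C)
    (hdC : ∀ n, ∫⁻ x, ‖fderiv ℝ (w n) x‖ₑ ∂μ ≤ C)
    (hball : ∀ x r, Tendsto (fun n => ∫ t in Metric.ball 0 r, w n (x + t) ∂μ) atTop (𝓝 0))
    {s : Set E} (hs : μ s ≠ ⊤) :
    Tendsto (fun n => ∫⁻ x in s, ‖w n x‖ₑ ∂μ) atTop (𝓝 0) := by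
  refine ENNReal.tendsto_nhds_zero.2 fun η hη => ?_
  -- The averages over balls of radius `r` are uniformly close to the functions if `r` is small.
  obtain ⟨r, hr, hrη⟩ : ∃ r : ℝ, 0 < r ∧ ENNReal.ofReal r * C ≤ η / 2 := by
    have h1 : Tendsto (fun r : ℝ => ENNReal.ofReal r * C) (𝓝[>] 0) (𝓝 0) := by
      have h2 : Tendsto (fun r : ℝ => ENNReal.ofReal r * C) (𝓝 0) (𝓝 (ENNReal.ofReal 0 * C)) :=
        ENNReal.Tendsto.mul_const (ENNReal.tendsto_ofReal tendsto_id) (Or.inr (by simp))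
      rw [ENNReal.ofReal_zero, zero_mul] at h2
      exact h2.mono_left nhdsWithin_le_nhds
    have h3 := (ENNReal.tendsto_nhds_zero.1 h1) (η / 2) (ENNReal.half_pos hη.ne')
    obtain ⟨r, hr1, hr2⟩ := (h3.and self_mem_nhdsWithin).exists
    exact ⟨r, hr2, hr1⟩
  set V := μ (Metric.ball (0 : E) r) with hV
  have hV0 : V ≠ 0 := (Metric.measure_ball_pos μ 0 hr).ne'
  have hVtop : V ≠ ⊤ := measure_ball_lt_top.ne
  let h : ℕ → E → F := fun n x => ∫ t in Metric.ball 0 r, w n (x + t) ∂μ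
  have hhm : ∀ n, AEStronglyMeasurable (h n) μ := by
    intro n
    have hc : Continuous fun z : E × E => w n (z.1 + z.2) :=
      (hw n).continuous.comp continuous_add
    exact AEStronglyMeasurable.integral_prod_right'
      (hc.aestronglyMeasurable (μ := μ.prod (μ.restrict (Metric.ball 0 r))))
  have hhb : ∀ n x, ‖h n x‖ₑ ≤ C := by
    intro n x
    refine (enorm_integral_le_lintegral_enorm _).trans ((setLIntegral_le_lintegral _ _).trans ?_)
    rw [lintegral_add_left_eq_self (fun t => ‖w n t‖ₑ) x]
    exact hC n
  have hh : Tendsto (fun n => ∫⁻ x in s, ‖h n x‖ₑ ∂μ) atTop (𝓝 (∫⁻ _ in s, 0 ∂μ)) := by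
    refine tendsto_lintegral_of_dominated_convergence' (fun _ => (C : ℝ≥0∞))
      (fun n => (hhm n).enorm.restrict) (fun n => .of_forall fun x => hhb n x) ?_
      (.of_forall fun x => ?_)
    · rw [setLIntegral_const]
      exact ENNReal.mul_ne_top ENNReal.coe_ne_top hs
    · have := (hball x r).enorm
      rwa [enorm_zero] at this
  rw [lintegral_zero] at hh
  have hVη : 0 < V * (η / 2) := pos_iff_ne_zero.2 (mul_ne_zero hV0 (ENNReal.half_pos hη.ne').ne')
  filter_upwards [ENNReal.tendsto_nhds_zero.1 hh _ hVη] with n hn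
  refine (ENNReal.mul_le_mul_iff_right hV0 hVtop).1 ?_
  calc V * ∫⁻ x in s, ‖w n x‖ₑ ∂μ = ∫⁻ x in s, V * ‖w n x‖ₑ ∂μ :=
        (lintegral_const_mul' _ _ hVtop).symm
    _ ≤ ∫⁻ x in s, (‖μ.real (Metric.ball 0 r) • w n x - h n x‖ₑ + ‖h n x‖ₑ) ∂μ := by
        refine lintegral_mono fun x => ?_
        have h1 : V * ‖w n x‖ₑ = ‖μ.real (Metric.ball 0 r) • w n x‖ₑ := by
          rw [enorm_smul, Real.enorm_of_nonneg measureReal_nonneg, ofReal_measureReal hVtop]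
        rw [h1]
        have h2 := enorm_add_le (μ.real (Metric.ball 0 r) • w n x - h n x) (h n x)
        rwa [sub_add_cancel] at h2
    _ = ∫⁻ x in s, ‖μ.real (Metric.ball 0 r) • w n x - h n x‖ₑ ∂μ + ∫⁻ x in s, ‖h n x‖ₑ ∂μ :=
        lintegral_add_right' _ (hhm n).enorm.restrict
    _ ≤ V * (ENNReal.ofReal r * C) + V * (η / 2) := by
        refine add_le_add ?_ hn
        refine (setLIntegral_le_lintegral _ _).trans ?_
        refine (lintegral_enorm_smul_sub_setIntegral_ball_le μ (hw n) r).trans ?_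
        gcongr
        exact hdC n
    _ ≤ V * (η / 2) + V * (η / 2) := by gcongr
    _ = V * η := by rw [← mul_add, ENNReal.add_halves]

end StrongL1

section Measure

variable {α : Type*} [MeasurableSpace α] {μ : Measure α}

/-- Sets of small measure are small for an equivalent finite measure, by absolute continuity of the
integral of the density. -/
theorem tendsto_toFinite_of_tendsto [SigmaFinite μ] {A : ℕ → Set α}
    (h : Tendsto (fun n => μ (A n)) atTop (𝓝 0)) :
    Tendsto (fun n => μ.toFinite (A n)) atTop (𝓝 0) := by
  have h1 : ∫⁻ x, μ.toFinite.rnDeriv μ x ∂μ ≠ ⊤ :=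
    (Measure.lintegral_rnDeriv_lt_top _ _).ne
  have h2 := tendsto_setLIntegral_zero h1 h
  refine h2.congr fun n => ?_
  exact Measure.setLIntegral_rnDeriv (toFinite_absolutelyContinuous μ) _

theorem exists_seq_ae_tendsto_of_tendsto_integral_norm_sub {F : Type*} [NormedAddCommGroup F]
    {f : ℕ → α → F} {g : α → F} (hf : ∀ n, Integrable (f n) μ) (hg : Integrable g μ)
    (h : Tendsto (fun n => ∫ x, ‖f n x - g x‖ ∂μ) atTop (𝓝 0)) :
    ∃ ns : ℕ → ℕ, StrictMono ns ∧
      ∀ᵐ x ∂μ, Tendsto (fun n => f (ns n) x) atTop (𝓝 (g x)) := by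
  refine (tendstoInMeasure_of_tendsto_eLpNorm (p := 1) one_ne_zero
    (fun n => (hf n).aestronglyMeasurable) hg.aestronglyMeasurable ?_).exists_seq_tendsto_ae
  have := ENNReal.tendsto_ofReal h
  rw [ENNReal.ofReal_zero] at this
  refine this.congr fun n => ?_
  rw [eLpNorm_one_eq_lintegral_enorm]
  exact ofReal_integral_norm_eq_lintegral_enorm ((hf n).sub hg)

end Measure

/-! ### The Sobolev inequality and the critical convergence on the whole space -/

section WholeSpace

variable {d m : ℕ}

/-- The critical exponent `d / (d - 1)` as an element of `ℝ≥0`, as the Gagliardo–Nirenberg–Sobolev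
inequality takes it. Its coercion to `ℝ≥0∞` is `critExp d` by definition. -/
noncomputable def critExpNNReal (d : ℕ) : NNReal := ((d : ℝ) / ((d : ℝ) - 1)).toNNReal

theorem holderConjugate_critExpNNReal [hd : Fact (2 ≤ d)] :
    NNReal.HolderConjugate (Module.finrank ℝ (EuclideanSpace ℝ (Fin d))) (critExpNNReal d) := by
  have h2 : (2 : ℝ) ≤ d := by exact_mod_cast hd.out
  rw [finrank_euclideanSpace_fin, ← NNReal.holderConjugate_coe_iff, critExpNNReal,
    Real.coe_toNNReal _ (div_nonneg (by linarith) (by linarith))]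
  exact (Real.HolderConjugate.conjExponent (by simpa using (by linarith : (1 : ℝ) < d)))

theorem ofReal_integral_norm_sub_eq_lintegral_enorm {α : Type*} [MeasurableSpace α] {μ : Measure α}
    {F : Type*} [NormedAddCommGroup F] {f g : α → F} (hf : Integrable f μ) (hg : Integrable g μ) :
    ENNReal.ofReal (∫ x, ‖f x - g x‖ ∂μ) = ∫⁻ x, ‖f x - g x‖ₑ ∂μ :=
  ofReal_integral_norm_eq_lintegral_enorm (hf.sub hg)

theorem lintegral_enorm_le_add_of_integral_norm_sub_le {α : Type*} [MeasurableSpace α]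
    {μ : Measure α} {F : Type*} [NormedAddCommGroup F] {f g : α → F} (hf : Integrable f μ)
    (hg : Integrable g μ) {ε : ℝ} (h : ∫ x, ‖f x - g x‖ ∂μ ≤ ε) (s : Set α) :
    ∫⁻ x in s, ‖f x‖ₑ ∂μ ≤ ∫⁻ x in s, ‖g x‖ₑ ∂μ + ENNReal.ofReal ε := by
  calc ∫⁻ x in s, ‖f x‖ₑ ∂μ ≤ ∫⁻ x in s, (‖g x‖ₑ + ‖f x - g x‖ₑ) ∂μ := by
        refine lintegral_mono fun x => ?_
        have := enorm_add_le (g x) (f x - g x)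
        rwa [add_sub_cancel] at this
    _ = ∫⁻ x in s, ‖g x‖ₑ ∂μ + ∫⁻ x in s, ‖f x - g x‖ₑ ∂μ :=
        lintegral_add_left' hg.aestronglyMeasurable.enorm.restrict _
    _ ≤ _ := by
        gcongr
        refine (setLIntegral_le_lintegral _ _).trans ?_
        rw [← ofReal_integral_norm_sub_eq_lintegral_enorm hf hg]
        exact ENNReal.ofReal_le_ofReal h

variable {u : EuclideanSpace ℝ (Fin d) → EuclideanSpace ℝ (Fin m)}
  {G : EuclideanSpace ℝ (Fin d) → (EuclideanSpace ℝ (Fin d) →L[ℝ] EuclideanSpace ℝ (Fin m))}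

theorem hasWeakFDerivOn_fderiv (O : Set (EuclideanSpace ℝ (Fin d))) (hu : ContDiff ℝ 1 u) :
    HasWeakFDerivOn O u (fderiv ℝ u) := by
  intro φ hφ hc hs v
  have hφ1 : ContDiff ℝ 1 φ := hφ.of_le (by exact_mod_cast le_top)
  have hdφ : Continuous fun x => fderiv ℝ φ x v :=
    (hφ1.continuous_fderiv one_ne_zero).clm_apply continuous_const
  have hdu : Continuous fun x => fderiv ℝ u x v :=
    (hu.continuous_fderiv one_ne_zero).clm_apply continuous_const
  have h := integral_smul_fderiv_eq_neg_fderiv_smul_of_integrable (μ := volume) (v := v)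
    ((hdφ.smul hu.continuous).integrable_of_hasCompactSupport (hc.fderiv_apply ℝ v).smul_right)
    ((hφ.continuous.smul hdu).integrable_of_hasCompactSupport hc.smul_right)
    ((hφ.continuous.smul hu.continuous).integrable_of_hasCompactSupport hc.smul_right)
    (fun x _ => hφ1.differentiable one_ne_zero x) (fun x _ => hu.differentiable one_ne_zero x)
  rw [setIntegral_eq_integral_of_forall_compl_eq_zero fun x hx => ?_,
    setIntegral_eq_integral_of_forall_compl_eq_zero fun x hx => ?_, h, neg_neg]
  · rw [image_eq_zero_of_notMem_tsupport fun hx' => hx (hs hx'), zero_smul]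
  · have h0 : x ∉ tsupport (fderiv ℝ φ) := fun hx' => hx (hs (tsupport_fderiv_subset ℝ hx'))
    rw [image_eq_zero_of_notMem_tsupport h0, zero_apply, zero_smul]

theorem HasWeakFDerivOn.sub {O : Set (EuclideanSpace ℝ (Fin d))}
    {u' : EuclideanSpace ℝ (Fin d) → EuclideanSpace ℝ (Fin m)}
    {G' : EuclideanSpace ℝ (Fin d) → (EuclideanSpace ℝ (Fin d) →L[ℝ] EuclideanSpace ℝ (Fin m))}
    (h : HasWeakFDerivOn O u G) (h' : HasWeakFDerivOn O u' G')
    (hu : IntegrableOn u O) (hG : IntegrableOn G O) (hu' : IntegrableOn u' O)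
    (hG' : IntegrableOn G' O) : HasWeakFDerivOn O (u - u') (G - G') := by
  intro φ hφ hc hs v
  obtain ⟨a, ha⟩ := hc.exists_bound_of_continuous hφ.continuous
  have hdφ : Continuous fun x => fderiv ℝ φ x v :=
    (hφ.continuous_fderiv (by simp)).clm_apply continuous_const
  obtain ⟨b, hb⟩ := (hc.fderiv_apply ℝ v).exists_bound_of_continuous hdφ
  have i1 : ∀ {f : EuclideanSpace ℝ (Fin d) → EuclideanSpace ℝ (Fin m)}, IntegrableOn f O →
      IntegrableOn (fun x => fderiv ℝ φ x v • f x) O := fun hf =>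
    hf.bdd_smul b hdφ.aestronglyMeasurable (.of_forall hb)
  have i2 : ∀ {f : EuclideanSpace ℝ (Fin d) →
      (EuclideanSpace ℝ (Fin d) →L[ℝ] EuclideanSpace ℝ (Fin m))}, IntegrableOn f O →
      IntegrableOn (fun x => φ x • f x v) O := fun hf =>
    (hf.apply_continuousLinearMap v).bdd_smul a hφ.continuous.aestronglyMeasurable (.of_forall ha)
  simp only [Pi.sub_apply, sub_apply, smul_sub]
  rw [integral_sub (i1 hu) (i1 hu'), integral_sub (i2 hG) (i2 hG'), h φ hφ hc hs v,
    h' φ hφ hc hs v]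
  abel

/-- The Gagliardo–Nirenberg–Sobolev inequality for weakly differentiable functions. -/
theorem eLpNorm_critExp_le_lintegral_enorm [Fact (2 ≤ d)] (hu : Integrable u) (hG : Integrable G)
    (h : HasWeakFDerivOn Set.univ u G) :
    eLpNorm u (critExp d) volume ≤
      eLpNormLESNormFDerivOneConst (volume : Measure (EuclideanSpace ℝ (Fin d)))
        (critExpNNReal d) * ∫⁻ x, ‖G x‖ₑ := by
  choose w hw hwc hwu hwG using fun n : ℕ =>
    exists_contDiff_integral_norm_sub_lt hu hG h (ε := 1 / ((n : ℝ) + 1)) (by positivity)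
  have hwi : ∀ n, Integrable (w n) := fun n =>
    (hw n).continuous.integrable_of_hasCompactSupport (hwc n)
  have hlim : Tendsto (fun n => ∫ x, ‖w n x - u x‖) atTop (𝓝 0) :=
    squeeze_zero (fun n => integral_nonneg fun x => norm_nonneg _) (fun n => (hwu n).le)
      tendsto_one_div_add_atTop_nhds_zero_nat
  obtain ⟨ns, hns, hae⟩ := exists_seq_ae_tendsto_of_tendsto_integral_norm_sub hwi hu hlim
  refine (Lp.eLpNorm_lim_le_liminf_eLpNorm
    (fun n => (hw (ns n)).continuous.aestronglyMeasurable) u hae).trans ?_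
  set C := eLpNormLESNormFDerivOneConst (volume : Measure (EuclideanSpace ℝ (Fin d)))
    (critExpNNReal d)
  have hbound : ∀ n, eLpNorm (w (ns n)) (critExp d) volume ≤
      C * ((∫⁻ x, ‖G x‖ₑ) + ENNReal.ofReal (1 / ((ns n : ℝ) + 1))) := by
    intro n
    refine (eLpNorm_le_eLpNorm_fderiv_one volume (hw (ns n)) (hwc (ns n))
      holderConjugate_critExpNNReal).trans ?_
    gcongr
    rw [eLpNorm_one_eq_lintegral_enorm]
    have h1 := lintegral_enorm_le_add_of_integral_norm_sub_le
      ((hw (ns n)).integrable_fderiv_of_hasCompactSupport (hwc (ns n))) hG (hwG (ns n)).le Set.univ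
    rwa [setLIntegral_univ, setLIntegral_univ] at h1
  have hlim2 : Tendsto (fun n => C * ((∫⁻ x, ‖G x‖ₑ) + ENNReal.ofReal (1 / ((ns n : ℝ) + 1))))
      atTop (𝓝 (C * ((∫⁻ x, ‖G x‖ₑ) + ENNReal.ofReal 0))) := by
    refine ENNReal.Tendsto.const_mul (tendsto_const_nhds.add (ENNReal.tendsto_ofReal ?_))
      (Or.inr ENNReal.coe_ne_top)
    exact tendsto_one_div_add_atTop_nhds_zero_nat.comp hns.tendsto_atTop
  rw [ENNReal.ofReal_zero, add_zero] at hlim2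
  rw [← hlim2.liminf_eq]
  exact liminf_le_liminf (.of_forall hbound)

/-- Sequences that are weakly null in `W^{1,1}(ℝᵈ)` are strongly null in the critical Lebesgue
space. Equi-integrability and tightness give strong convergence in `L¹`; the sets where the
functions exceed one then have small measure, hence carry little of the gradients. -/
theorem tendsto_eLpNorm_critExp_of_weaklyNullL1 [Fact (2 ≤ d)]
    {u : ℕ → EuclideanSpace ℝ (Fin d) → EuclideanSpace ℝ (Fin m)}
    {G : ℕ → EuclideanSpace ℝ (Fin d) →
      (EuclideanSpace ℝ (Fin d) →L[ℝ] EuclideanSpace ℝ (Fin m))}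
    (hu : ∀ n, Integrable (u n)) (hG : ∀ n, Integrable (G n))
    (hum : ∀ n, StronglyMeasurable (u n)) (hGm : ∀ n, StronglyMeasurable (G n))
    (h : ∀ n, HasWeakFDerivOn Set.univ (u n) (G n))
    (hun : WeaklyNullL1 volume u) (hGn : WeaklyNullL1 volume G) {C : NNReal}
    (huC : ∀ n, ∫⁻ x, ‖u n x‖ₑ ≤ C) (hGC : ∀ n, ∫⁻ x, ‖G n x‖ₑ ≤ C) :
    Tendsto (fun n => eLpNorm (u n) (critExp d) volume) atTop (𝓝 0) := by
  -- Smooth compactly supported approximants `w n` of `u n` inherit all that is needed.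
  choose w hw hwc hwu hwG using fun n : ℕ =>
    exists_contDiff_integral_norm_sub_lt (hu n) (hG n) (h n)
      (ε := 1 / ((n : ℝ) + 1)) (by positivity)
  have hwi : ∀ n, Integrable (w n) := fun n =>
    (hw n).continuous.integrable_of_hasCompactSupport (hwc n)
  have hdwi : ∀ n, Integrable (fderiv ℝ (w n)) := fun n =>
    (hw n).integrable_fderiv_of_hasCompactSupport (hwc n)
  let μ : Measure (EuclideanSpace ℝ (Fin d)) := volume
  let ν := μ.toFinite
  have hμν : μ ≪ ν := absolutelyContinuous_toFinite μ
  have hε : Tendsto (fun n : ℕ => ENNReal.ofReal (1 / ((n : ℝ) + 1))) atTop (𝓝 0) := by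
    have := ENNReal.tendsto_ofReal (tendsto_one_div_add_atTop_nhds_zero_nat (𝕜 := ℝ))
    rwa [ENNReal.ofReal_zero] at this
  have hε1 : ∀ n : ℕ, ENNReal.ofReal (1 / ((n : ℝ) + 1)) ≤ 1 := by
    intro n
    rw [ENNReal.ofReal_le_one, div_le_one (by positivity)]
    linarith [Nat.cast_nonneg (α := ℝ) n]
  have hwle : ∀ n s, ∫⁻ x in s, ‖w n x‖ₑ ≤
      (∫⁻ x in s, ‖u n x‖ₑ) + ENNReal.ofReal (1 / ((n : ℝ) + 1)) := fun n s =>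
    lintegral_enorm_le_add_of_integral_norm_sub_le (hwi n) (hu n) (hwu n).le s
  have hdwle : ∀ n s, ∫⁻ x in s, ‖fderiv ℝ (w n) x‖ₑ ≤
      (∫⁻ x in s, ‖G n x‖ₑ) + ENNReal.ofReal (1 / ((n : ℝ) + 1)) := fun n s =>
    lintegral_enorm_le_add_of_integral_norm_sub_le (hdwi n) (hG n) (hwG n).le s
  have hwC : ∀ n, ∫⁻ x, ‖w n x‖ₑ ≤ (C + 1 : NNReal) := by
    intro n
    have h1 := hwle n Set.univ
    rw [setLIntegral_univ, setLIntegral_univ] at h1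
    push_cast
    exact h1.trans (add_le_add (huC n) (hε1 n))
  have hdwC : ∀ n, ∫⁻ x, ‖fderiv ℝ (w n) x‖ₑ ≤ (C + 1 : NNReal) := by
    intro n
    have h1 := hdwle n Set.univ
    rw [setLIntegral_univ, setLIntegral_univ] at h1
    push_cast
    exact h1.trans (add_le_add (hGC n) (hε1 n))
  -- The integral over a fixed ball is a weakly continuous functional.
  have hball : ∀ x r, Tendsto (fun n => ∫ t in Metric.ball 0 r, w n (x + t)) atTop (𝓝 0) := by
    intro x r
    have e : ∀ f : EuclideanSpace ℝ (Fin d) → EuclideanSpace ℝ (Fin m),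
        ∫ t in Metric.ball 0 r, f (x + t) = ∫ t in Metric.ball x r, f t := by
      intro f
      rw [← integral_indicator measurableSet_ball, ← integral_indicator measurableSet_ball,
        ← integral_add_left_eq_self ((Metric.ball x r).indicator f) x]
      refine integral_congr_ae (.of_forall fun t => ?_)
      simp [Set.indicator]
    simp_rw [e]
    have h1 := hun.tendsto_setIntegral hu (measurableSet_ball (x := x) (ε := r))
    have h2 : Tendsto (fun n => ∫ t in Metric.ball x r, (w n t - u n t)) atTop (𝓝 0) := by
      refine squeeze_zero_norm (fun n => ?_) (tendsto_one_div_add_atTop_nhds_zero_nat (𝕜 := ℝ))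
      refine (norm_integral_le_integral_norm _).trans (le_trans ?_ (hwu n).le)
      exact setIntegral_le_integral ((hwi n).sub (hu n)).norm (.of_forall fun x => norm_nonneg _)
    have h3 := h1.add h2
    rw [add_zero] at h3
    refine h3.congr fun n => ?_
    rw [integral_sub (hwi n).integrableOn (hu n).integrableOn]
    simp
  have hL1 : Tendsto (fun n => ∫⁻ x, ‖w n x‖ₑ) atTop (𝓝 0) := by
    refine ENNReal.tendsto_nhds_zero.2 fun η hη => ?_
    -- Tightness: the complements of large balls have small measure with respect to `ν`.
    obtain ⟨δ', hδ'0, hδ'η⟩ : ∃ δ' : ℝ, 0 < δ' ∧ ENNReal.ofReal δ' ≤ η / 3 := by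
      rcases eq_or_ne η ⊤ with rfl | hηt
      · exact ⟨1, one_pos, by simp [ENNReal.top_div]⟩
      · refine ⟨(η / 3).toReal, ENNReal.toReal_pos ?_ ?_, ENNReal.ofReal_toReal_le⟩
        · exact (ENNReal.div_pos hη.ne' (by simp)).ne'
        · exact (ENNReal.div_lt_top hηt (by simp)).ne
    obtain ⟨δ, hδ, N, hN⟩ := exists_forall_setLIntegral_enorm_le hμν hu hum hun hδ'0
    have htail : Tendsto (fun R : ℕ => ν ((Metric.closedBall 0 (R : ℝ))ᶜ)) atTop (𝓝 0) := by
      have h1 : ⋂ R : ℕ, (Metric.closedBall (0 : EuclideanSpace ℝ (Fin d)) (R : ℝ))ᶜ = ∅ := by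
        rw [← Set.compl_iUnion, Metric.iUnion_closedBall_nat, Set.compl_univ]
      have h2 := tendsto_measure_iInter_atTop (μ := ν)
        (s := fun R : ℕ => (Metric.closedBall (0 : EuclideanSpace ℝ (Fin d)) (R : ℝ))ᶜ)
        (fun R => measurableSet_closedBall.compl.nullMeasurableSet)
        (fun R S hRS => Set.compl_subset_compl.2
          (Metric.closedBall_subset_closedBall (by exact_mod_cast hRS)))
        ⟨0, measure_ne_top _ _⟩
      rwa [h1, measure_empty] at h2
    obtain ⟨R, hR⟩ := (ENNReal.tendsto_nhds_zero.1 htail (ENNReal.ofReal δ)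
      (ENNReal.ofReal_pos.2 hδ)).exists
    have hR' : ν.real ((Metric.closedBall 0 (R : ℝ))ᶜ) ≤ δ :=
      ENNReal.toReal_le_of_le_ofReal hδ.le hR
    have hη3 : 0 < η / 3 := ENNReal.div_pos hη.ne' (by simp)
    have hloc := tendsto_setLIntegral_enorm_of_tendsto_setIntegral_ball volume hw hwC hdwC hball
      (s := Metric.closedBall 0 (R : ℝ)) measure_closedBall_lt_top.ne
    filter_upwards [ENNReal.tendsto_nhds_zero.1 hloc _ hη3, eventually_ge_atTop N,
      ENNReal.tendsto_nhds_zero.1 hε _ hη3] with n hn1 hn2 hn3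
    rw [← lintegral_add_compl _ (measurableSet_closedBall (x := 0) (ε := (R : ℝ)))]
    calc _ ≤ η / 3 + (η / 3 + η / 3) := by
          refine add_le_add hn1 ((hwle n _).trans (add_le_add ?_ hn3))
          exact (hN n hn2 _ measurableSet_closedBall.compl hR').trans hδ'η
      _ = η := by rw [← add_assoc, ENNReal.add_thirds]
  have hdL1 : Tendsto (fun n => ∫⁻ x in {x | 1 ≤ ‖w n x‖}, ‖fderiv ℝ (w n) x‖ₑ) atTop (𝓝 0) := by
    -- Chebyshev's inequality, and equi-integrability of the gradients.
    have hmeas : Tendsto (fun n => μ {x | 1 ≤ ‖w n x‖}) atTop (𝓝 0) := by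
      refine tendsto_of_tendsto_of_tendsto_of_le_of_le tendsto_const_nhds hL1
        (fun n => zero_le) fun n => ?_
      have h1 := mul_meas_ge_le_lintegral₀ (μ := μ) (hwi n).aestronglyMeasurable.enorm 1
      rw [one_mul] at h1
      refine le_trans (measure_mono fun x hx => ?_) h1
      have hx' : 1 ≤ ‖w n x‖ := hx
      change 1 ≤ ‖w n x‖ₑ
      rw [← ofReal_norm]
      exact ENNReal.one_le_ofReal.2 hx'
    have hν := tendsto_toFinite_of_tendsto hmeas
    have hGs : Tendsto (fun n => ∫⁻ x in {x | 1 ≤ ‖w n x‖}, ‖G n x‖ₑ) atTop (𝓝 0) := by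
      refine ENNReal.tendsto_nhds_zero.2 fun η hη => ?_
      obtain ⟨δ', hδ'0, hδ'η⟩ : ∃ δ' : ℝ, 0 < δ' ∧ ENNReal.ofReal δ' ≤ η := by
        rcases eq_or_ne η ⊤ with rfl | hηt
        · exact ⟨1, one_pos, le_top⟩
        · exact ⟨η.toReal, ENNReal.toReal_pos hη.ne' hηt, ENNReal.ofReal_toReal_le⟩
      obtain ⟨δ, hδ, N, hN⟩ := exists_forall_setLIntegral_enorm_le hμν hG hGm hGn hδ'0
      filter_upwards [ENNReal.tendsto_nhds_zero.1 hν (ENNReal.ofReal δ) (ENNReal.ofReal_pos.2 hδ),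
        eventually_ge_atTop N] with n hn1 hn2
      refine (hN n hn2 _ ?_ (ENNReal.toReal_le_of_le_ofReal hδ.le hn1)).trans hδ'η
      exact (isClosed_le continuous_const (hw n).continuous.norm).measurableSet
    have hsum := hGs.add hε
    rw [add_zero] at hsum
    refine tendsto_of_tendsto_of_tendsto_of_le_of_le tendsto_const_nhds hsum (fun n => zero_le)
      fun n => hdwle n _
  -- Both terms in the truncated Sobolev inequality tend to zero.
  have hp := holderConjugate_critExpNNReal (d := d)
  have hp0 : (0 : ℝ) < critExpNNReal d := by exact_mod_cast hp.symm.pos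
  obtain ⟨K, hK⟩ := exists_eLpNorm_le_add_setLIntegral_fderiv
    (F := EuclideanSpace ℝ (Fin m)) (volume : Measure (EuclideanSpace ℝ (Fin d))) hp
  have hwp : Tendsto (fun n => eLpNorm (w n) (critExp d) volume) atTop (𝓝 0) := by
    have h1 : Tendsto (fun n => (2 ^ ((critExpNNReal d : ℝ) - 1) * ∫⁻ x, ‖w n x‖ₑ) ^
        (1 / (critExpNNReal d : ℝ))) atTop (𝓝 0) := by
      have h2 := ENNReal.Tendsto.const_mul (a := 2 ^ ((critExpNNReal d : ℝ) - 1)) hL1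
        (Or.inr (by finiteness))
      have h3 := h2.ennrpow_const (1 / (critExpNNReal d : ℝ))
      rwa [mul_zero, ENNReal.zero_rpow_of_pos (by positivity)] at h3
    have h4 := ENNReal.Tendsto.const_mul (a := (K : ℝ≥0∞)) hdL1 (Or.inr ENNReal.coe_ne_top)
    rw [mul_zero] at h4
    have hsum := h1.add h4
    rw [add_zero] at hsum
    refine tendsto_of_tendsto_of_tendsto_of_le_of_le tendsto_const_nhds hsum (fun n => zero_le)
      fun n => hK (w n) (hw n) (hwc n)
  -- The Sobolev inequality controls the error of the smooth approximation.
  have hdiff : Tendsto (fun n => eLpNorm (u n - w n) (critExp d) volume) atTop (𝓝 0) := by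
    set K := eLpNormLESNormFDerivOneConst (volume : Measure (EuclideanSpace ℝ (Fin d)))
      (critExpNNReal d)
    have h1 : Tendsto (fun n : ℕ => K * ENNReal.ofReal (1 / ((n : ℝ) + 1))) atTop (𝓝 0) := by
      have h2 := ENNReal.Tendsto.const_mul (a := (K : ℝ≥0∞)) hε (Or.inr ENNReal.coe_ne_top)
      rwa [mul_zero] at h2
    refine tendsto_of_tendsto_of_tendsto_of_le_of_le tendsto_const_nhds h1 (fun n => zero_le)
      fun n => ?_
    have h3 := (hasWeakFDerivOn_fderiv Set.univ (hw n)).sub (h n)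
      (by simpa using hwi n) (by simpa using hdwi n) (by simpa using hu n) (by simpa using hG n)
    rw [← eLpNorm_neg, neg_sub]
    refine (eLpNorm_critExp_le_lintegral_enorm ((hwi n).sub (hu n)) ((hdwi n).sub (hG n))
      h3).trans ?_
    gcongr
    have h4 := ENNReal.ofReal_le_ofReal (hwG n).le
    rwa [ofReal_integral_norm_sub_eq_lintegral_enorm (hdwi n) (hG n)] at h4
  have hsum := hwp.add hdiff
  rw [add_zero] at hsum
  refine tendsto_of_tendsto_of_tendsto_of_le_of_le tendsto_const_nhds hsum
    (fun n => zero_le) fun n => ?_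
  have h1 := eLpNorm_add_le (p := critExp d) (hwi n).aestronglyMeasurable
    ((hu n).sub (hwi n)).aestronglyMeasurable (fact_one_le_critExp d).out
  rwa [add_sub_cancel] at h1

end WholeSpace

/-! ### The embedding operator on extension domains -/

section Embedding

variable {d m : ℕ} {O : Set (EuclideanSpace ℝ (Fin d))}

/-- `W11.toL1` as a bounded operator. -/
noncomputable def W11.toL1CLM (d m : ℕ) (O : Set (EuclideanSpace ℝ (Fin d))) :
    W11 d m O →L[ℝ] Lp (EuclideanSpace ℝ (Fin m)) 1 (volume.restrict O) :=
  (WithLp.fstL 1 ℝ _ _).comp (W11 d m O).subtypeL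

/-- `W11.grad` as a bounded operator. -/
noncomputable def W11.gradCLM (d m : ℕ) (O : Set (EuclideanSpace ℝ (Fin d))) : W11 d m O →L[ℝ]
    Lp (EuclideanSpace ℝ (Fin d) →L[ℝ] EuclideanSpace ℝ (Fin m)) 1 (volume.restrict O) :=
  (WithLp.sndL 1 ℝ _ _).comp (W11 d m O).subtypeL

theorem W11.toL1CLM_apply (w : W11 d m O) : W11.toL1CLM d m O w = W11.toL1 w := rfl

theorem W11.gradCLM_apply (w : W11 d m O) : W11.gradCLM d m O w = W11.grad w := rfl

theorem W11.coeFn_toL1_add (v w : W11 d m O) :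
    W11.toL1 (v + w) =ᵐ[volume.restrict O] W11.toL1 v + W11.toL1 w := by
  have h : W11.toL1 (v + w) = W11.toL1 v + W11.toL1 w := (W11.toL1CLM d m O).map_add v w
  rw [h]
  exact Lp.coeFn_add _ _

theorem W11.coeFn_toL1_smul (c : ℝ) (w : W11 d m O) :
    W11.toL1 (c • w) =ᵐ[volume.restrict O] c • ⇑(W11.toL1 w) := by
  have h : W11.toL1 (c • w) = c • W11.toL1 w := (W11.toL1CLM d m O).map_smul c w
  rw [h]
  exact Lp.coeFn_smul _ _

theorem W11.norm_eq_add (w : W11 d m O) : ‖w‖ = ‖W11.toL1 w‖ + ‖W11.grad w‖ :=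
  WithLp.prod_norm_eq_of_L1 w.1

theorem W11.hasWeakFDerivOn (w : W11 d m O) : HasWeakFDerivOn O (W11.toL1 w) (W11.grad w) :=
  w.2

theorem W11.lintegral_enorm_toL1 (w : W11 d m O) :
    ∫⁻ x in O, ‖W11.toL1 w x‖ₑ = ENNReal.ofReal ‖W11.toL1 w‖ := by
  rw [L1.norm_eq_integral_norm, ofReal_integral_norm_eq_lintegral_enorm (L1.integrable_coeFn _)]

theorem W11.lintegral_enorm_grad (w : W11 d m O) :
    ∫⁻ x in O, ‖W11.grad w x‖ₑ = ENNReal.ofReal ‖W11.grad w‖ := by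
  rw [L1.norm_eq_integral_norm, ofReal_integral_norm_eq_lintegral_enorm (L1.integrable_coeFn _)]

theorem W11.integrable_toL1 (w : W11 d m Set.univ) : Integrable (W11.toL1 w) := by
  simpa using L1.integrable_coeFn (W11.toL1 w)

theorem W11.integrable_grad (w : W11 d m Set.univ) : Integrable (W11.grad w) := by
  simpa using L1.integrable_coeFn (W11.grad w)

/-- The Sobolev inequality on an extension domain: extend to the whole space, apply it there, and
restrict. -/
theorem IsW11ExtensionDomain.exists_eLpNorm_le [Fact (2 ≤ d)] (hO : IsW11ExtensionDomain d m O) :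
    ∃ C : NNReal, ∀ w : W11 d m O,
      eLpNorm (W11.toL1 w) (critExp d) (volume.restrict O) ≤ ENNReal.ofReal (C * ‖w‖) := by
  obtain ⟨-, E, hE⟩ := hO
  obtain ⟨B, hB, hEB⟩ := E.bound
  lift B to NNReal using hB.le
  refine ⟨eLpNormLESNormFDerivOneConst (volume : Measure (EuclideanSpace ℝ (Fin d)))
    (critExpNNReal d) * B, fun w => ?_⟩
  have h1 : ‖W11.grad (E w)‖ ≤ B * ‖w‖ := by
    refine le_trans ?_ (hEB w)
    rw [W11.norm_eq_add]
    linarith [norm_nonneg (W11.toL1 (E w))]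
  have h2 := eLpNorm_critExp_le_lintegral_enorm (W11.integrable_toL1 (E w))
    (W11.integrable_grad (E w)) (W11.hasWeakFDerivOn (E w))
  have h3 : ∫⁻ x, ‖W11.grad (E w) x‖ₑ ≤ ENNReal.ofReal (B * ‖w‖) :=
    ((setLIntegral_univ _).symm.trans (W11.lintegral_enorm_grad (E w))).le.trans
      (ENNReal.ofReal_le_ofReal h1)
  refine (eLpNorm_congr_ae (hE w)).symm.le.trans ((eLpNorm_restrict_le _ _ _ _).trans
    (h2.trans ((mul_le_mul_right h3 _).trans (le_of_eq ?_))))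
  simp only [NNReal.coe_mul, mul_assoc, ENNReal.ofReal_mul (NNReal.coe_nonneg _),
    ENNReal.ofReal_coe_nnreal]

theorem exists_isSobolevEmbedding [Fact (2 ≤ d)] {C : NNReal} (hC : ∀ w : W11 d m O,
    eLpNorm (W11.toL1 w) (critExp d) (volume.restrict O) ≤ ENNReal.ofReal (C * ‖w‖)) :
    ∃ T : W11 d m O →L[ℝ] LCrit d m O, IsSobolevEmbedding T := by
  have hmem : ∀ w : W11 d m O, MemLp (W11.toL1 w) (critExp d) (volume.restrict O) := fun w =>
    ⟨Lp.aestronglyMeasurable _, (hC w).trans_lt ENNReal.ofReal_lt_top⟩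
  let L : W11 d m O →ₗ[ℝ] LCrit d m O :=
    { toFun := fun w => (hmem w).toLp _
      map_add' := fun v w => by
        refine Eq.trans (MemLp.toLp_congr _ _ ?_) (MemLp.toLp_add (hmem v) (hmem w))
        exact W11.coeFn_toL1_add v w
      map_smul' := fun c w => by
        refine Eq.trans (MemLp.toLp_congr _ _ ?_) (MemLp.toLp_const_smul c (hmem w))
        exact W11.coeFn_toL1_smul c w }
  refine ⟨L.mkContinuous C fun w => ?_, fun w => (hmem w).coeFn_toLp⟩
  exact (Lp.norm_toLp _ (hmem w)).le.trans
    (ENNReal.toReal_le_of_le_ofReal (mul_nonneg C.coe_nonneg (norm_nonneg w)) (hC w))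

theorem IsSobolevEmbedding.eLpNorm_toL1 [Fact (2 ≤ d)] {T : W11 d m O →L[ℝ] LCrit d m O}
    (hT : IsSobolevEmbedding T) (w : W11 d m O) :
    eLpNorm (W11.toL1 w) (critExp d) (volume.restrict O) = ‖T w‖ₑ := by
  exact (eLpNorm_congr_ae (hT w)).symm.trans (Lp.enorm_def _).symm

/-- `tendsto_eLpNorm_critExp_of_weaklyNullL1` in terms of the Sobolev space: both the functions and
their gradients inherit weak convergence, since `W11.toL1` and `W11.grad` are bounded operators. -/
theorem tendsto_eLpNorm_toL1_of_weaklyConverges [Fact (2 ≤ d)] {x : ℕ → W11 d m Set.univ}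
    (hx : WeaklyConverges x 0) :
    Tendsto (fun n => eLpNorm (W11.toL1 (x n)) (critExp d) volume) atTop (𝓝 0) := by
  obtain ⟨C, hC⟩ := hx.exists_norm_le
  have hw1 := (hx.comp_clm (W11.toL1CLM d m Set.univ)).weaklyNullL1
  have hw2 := (hx.comp_clm (W11.gradCLM d m Set.univ)).weaklyNullL1
  simp only [W11.toL1CLM_apply, W11.gradCLM_apply, Measure.restrict_univ] at hw1 hw2
  have hb1 : ∀ n, ∫⁻ t, ‖W11.toL1 (x n) t‖ₑ ≤ C.toNNReal := by
    intro n
    refine ((setLIntegral_univ _).symm.trans (W11.lintegral_enorm_toL1 (x n))).le.trans ?_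
    refine ENNReal.ofReal_le_ofReal (le_trans ?_ (hC n))
    rw [W11.norm_eq_add]
    linarith [norm_nonneg (W11.grad (x n))]
  have hb2 : ∀ n, ∫⁻ t, ‖W11.grad (x n) t‖ₑ ≤ C.toNNReal := by
    intro n
    refine ((setLIntegral_univ _).symm.trans (W11.lintegral_enorm_grad (x n))).le.trans ?_
    refine ENNReal.ofReal_le_ofReal (le_trans ?_ (hC n))
    rw [W11.norm_eq_add]
    linarith [norm_nonneg (W11.toL1 (x n))]
  exact tendsto_eLpNorm_critExp_of_weaklyNullL1
    (fun n => W11.integrable_toL1 (x n)) (fun n => W11.integrable_grad (x n))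
    (fun n => Lp.stronglyMeasurable _) (fun n => Lp.stronglyMeasurable _)
    (fun n => W11.hasWeakFDerivOn (x n)) hw1 hw2 hb1 hb2

theorem IsSobolevEmbedding.isCompletelyContinuous [Fact (2 ≤ d)]
    (hO : IsW11ExtensionDomain d m O) {T : W11 d m O →L[ℝ] LCrit d m O}
    (hT : IsSobolevEmbedding T) : IsCompletelyContinuous T := by
  intro x y hxy
  obtain ⟨-, E, hE⟩ := hO
  have hz : WeaklyConverges (fun n => x n - y) 0 := hxy.sub_const
  have hlim := tendsto_eLpNorm_toL1_of_weaklyConverges (hz.comp_clm E)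
  have hT0 : Tendsto (fun n => ‖T (x n - y)‖ₑ) atTop (𝓝 0) := by
    refine tendsto_of_tendsto_of_tendsto_of_le_of_le tendsto_const_nhds hlim (fun n => zero_le)
      fun n => ?_
    refine (hT.eLpNorm_toL1 (x n - y)).symm.le.trans ?_
    exact (eLpNorm_congr_ae (hE (x n - y))).symm.le.trans (eLpNorm_restrict_le _ _ _ _)
  rw [tendsto_iff_norm_sub_tendsto_zero]
  refine ((ENNReal.tendsto_toReal ENNReal.zero_ne_top).comp hT0).congr fun n => ?_
  exact (toReal_enorm _).trans (congrArg norm (T.map_sub (x n) y))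

end Embedding

/-! ### Failure of compactness -/

section SmoothElements

variable {d m : ℕ} {O : Set (EuclideanSpace ℝ (Fin d))}

theorem HasWeakFDerivOn.congr_ae
    {u u' : EuclideanSpace ℝ (Fin d) → EuclideanSpace ℝ (Fin m)}
    {G G' : EuclideanSpace ℝ (Fin d) → (EuclideanSpace ℝ (Fin d) →L[ℝ] EuclideanSpace ℝ (Fin m))}
    (h : HasWeakFDerivOn O u G) (hu : u' =ᵐ[volume.restrict O] u)
    (hG : G' =ᵐ[volume.restrict O] G) : HasWeakFDerivOn O u' G' := by
  intro φ hφ hc hs v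
  have e1 : ∫ x in O, fderiv ℝ φ x v • u' x = ∫ x in O, fderiv ℝ φ x v • u x :=
    integral_congr_ae (by filter_upwards [hu] with x hx; rw [hx])
  have e2 : ∫ x in O, φ x • G' x v = ∫ x in O, φ x • G x v :=
    integral_congr_ae (by filter_upwards [hG] with x hx; rw [hx])
  rw [e1, e2, h φ hφ hc hs v]

theorem norm_toLp_restrict_le {α F : Type*} [MeasurableSpace α] {μ : Measure α} {s : Set α}
    [NormedAddCommGroup F] {f : α → F} (hf : Integrable f μ) (h : MemLp f 1 (μ.restrict s)) :
    ‖h.toLp f‖ ≤ ∫ x, ‖f x‖ ∂μ := by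
  have e : ∫ x in s, ‖h.toLp f x‖ ∂μ = ∫ x in s, ‖f x‖ ∂μ :=
    integral_congr_ae (by filter_upwards [h.coeFn_toLp] with x hx; rw [hx])
  rw [L1.norm_eq_integral_norm, e]
  exact setIntegral_le_integral hf.norm (.of_forall fun x => norm_nonneg _)

/-- A smooth compactly supported function defines an element of `W^{1,1}(O)`, even if its support
is not contained in `O`: only the test functions are supported in `O`. -/
theorem exists_W11_ae_eq_of_contDiff (O : Set (EuclideanSpace ℝ (Fin d)))
    {f : EuclideanSpace ℝ (Fin d) → EuclideanSpace ℝ (Fin m)} (hf : ContDiff ℝ 1 f)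
    (hc : HasCompactSupport f) :
    ∃ w : W11 d m O, W11.toL1 w =ᵐ[volume.restrict O] f ∧
      ‖w‖ ≤ (∫ x, ‖f x‖) + ∫ x, ‖fderiv ℝ f x‖ := by
  have hfi : Integrable f := hf.continuous.integrable_of_hasCompactSupport hc
  have hdfi : Integrable (fderiv ℝ f) := hf.integrable_fderiv_of_hasCompactSupport hc
  have hf1 : MemLp f 1 (volume.restrict O) := memLp_one_iff_integrable.2 hfi.integrableOn
  have hdf1 : MemLp (fderiv ℝ f) 1 (volume.restrict O) :=
    memLp_one_iff_integrable.2 hdfi.integrableOn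
  let w : W11 d m O := ⟨WithLp.toLp 1 (hf1.toLp f, hdf1.toLp (fderiv ℝ f)),
    (hasWeakFDerivOn_fderiv O hf).congr_ae hf1.coeFn_toLp hdf1.coeFn_toLp⟩
  refine ⟨w, hf1.coeFn_toLp, ?_⟩
  rw [W11.norm_eq_add]
  exact add_le_add (norm_toLp_restrict_le hfi hf1) (norm_toLp_restrict_le hdfi hdf1)

end SmoothElements

section NonCompact

variable {d m : ℕ} {O : Set (EuclideanSpace ℝ (Fin d))}

/-- The bump function used for the concentrating sequence. -/
noncomputable def unitBump (d : ℕ) : ContDiffBump (0 : EuclideanSpace ℝ (Fin d)) :=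
  ⟨1, 2, one_pos, one_lt_two⟩

/-- The bump function concentrated at `x₀` at scale `1 / k`, times the vector `e`. The factor
`k ^ (d - 1)` makes the `L¹` norm of the gradient and the critical norm independent of `k`. -/
noncomputable def concentratingBump (x₀ : EuclideanSpace ℝ (Fin d)) (e : EuclideanSpace ℝ (Fin m))
    (k : ℝ) (x : EuclideanSpace ℝ (Fin d)) : EuclideanSpace ℝ (Fin m) :=
  (k ^ (d - 1) * unitBump d (k • (x - x₀))) • e

variable (x₀ : EuclideanSpace ℝ (Fin d)) {e : EuclideanSpace ℝ (Fin m)}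

theorem contDiff_concentratingBump (e : EuclideanSpace ℝ (Fin m)) (k : ℝ) :
    ContDiff ℝ 1 (concentratingBump x₀ e k) :=
  (contDiff_const.mul ((unitBump d).contDiff.comp
    ((contDiff_id.sub contDiff_const).const_smul k))).smul contDiff_const

theorem hasCompactSupport_concentratingBump (e : EuclideanSpace ℝ (Fin m)) {k : ℝ} (hk : 0 < k) :
    HasCompactSupport (concentratingBump x₀ e k) :=
  (((unitBump d).hasCompactSupport.comp_homeomorph
    ((Homeomorph.subRight x₀).trans (Homeomorph.smulOfNeZero k hk.ne'))).mul_left).smul_right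

theorem fderiv_concentratingBump (k : ℝ) (x : EuclideanSpace ℝ (Fin d)) :
    fderiv ℝ (concentratingBump x₀ e k) x =
      (k ^ (d - 1) • (k • fderiv ℝ (unitBump d) (k • (x - x₀)))).smulRight e := by
  have hχ : ContDiff ℝ 1 (unitBump d) := (unitBump d).contDiff
  have h0 : HasFDerivAt (fun x => k • (x - x₀))
      (k • ContinuousLinearMap.id ℝ (EuclideanSpace ℝ (Fin d))) x :=
    ((hasFDerivAt_id x).sub_const x₀).const_smul k
  have h1 : HasFDerivAt (fun x => unitBump d (k • (x - x₀)))
      ((fderiv ℝ (unitBump d) (k • (x - x₀))).comp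
        (k • ContinuousLinearMap.id ℝ (EuclideanSpace ℝ (Fin d)))) x :=
    HasFDerivAt.comp (g := fun y => unitBump d y) x
      ((hχ.differentiable one_ne_zero) (k • (x - x₀))).hasFDerivAt h0
  rw [ContinuousLinearMap.comp_smul, ContinuousLinearMap.comp_id] at h1
  exact ((h1.const_mul (k ^ (d - 1))).smul_const e).fderiv

theorem integral_comp_smul_sub (f : EuclideanSpace ℝ (Fin d) → ℝ) {k : ℝ} (hk : 0 < k) :
    ∫ x, f (k • (x - x₀)) = (k ^ d)⁻¹ * ∫ x, f x := by
  rw [integral_sub_right_eq_self (fun x => f (k • x)) x₀, Measure.integral_comp_smul,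
    finrank_euclideanSpace_fin, smul_eq_mul, abs_of_pos (by positivity)]

theorem integral_norm_concentratingBump_le (he : ‖e‖ = 1) {k : ℝ} (hk : 1 ≤ k) :
    ∫ x, ‖concentratingBump x₀ e k x‖ ≤ ∫ x, ‖unitBump d x‖ := by
  have hk0 : 0 < k := by linarith
  have h1 : ∀ x, ‖concentratingBump x₀ e k x‖ = k ^ (d - 1) * ‖unitBump d (k • (x - x₀))‖ := by
    intro x
    rw [concentratingBump, norm_smul, he, mul_one, norm_mul, Real.norm_of_nonneg (by positivity)]
  simp_rw [h1]
  rw [integral_const_mul, integral_comp_smul_sub x₀ (fun x => ‖unitBump d x‖) hk0, ← mul_assoc]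
  refine mul_le_of_le_one_left (integral_nonneg fun x => norm_nonneg _) ?_
  rw [← div_eq_mul_inv, div_le_one (by positivity)]
  exact pow_le_pow_right₀ hk (Nat.sub_le d 1)

theorem integral_norm_fderiv_concentratingBump [hd : Fact (2 ≤ d)] (he : ‖e‖ = 1) {k : ℝ}
    (hk : 0 < k) :
    ∫ x, ‖fderiv ℝ (concentratingBump x₀ e k) x‖ = ∫ x, ‖fderiv ℝ (unitBump d) x‖ := by
  have h1 : ∀ x, ‖fderiv ℝ (concentratingBump x₀ e k) x‖ =
      k ^ d * ‖fderiv ℝ (unitBump d) (k • (x - x₀))‖ := by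
    intro x
    rw [fderiv_concentratingBump, ContinuousLinearMap.norm_smulRight_apply, he, mul_one, norm_smul,
      norm_smul, Real.norm_of_nonneg (by positivity), Real.norm_of_nonneg hk.le, ← mul_assoc,
      ← pow_succ, Nat.sub_add_cancel (by have := hd.out; omega)]
  simp_rw [h1]
  rw [integral_const_mul, integral_comp_smul_sub x₀ (fun x => ‖fderiv ℝ (unitBump d) x‖) hk,
    ← mul_assoc, mul_inv_cancel₀ (by positivity), one_mul]

theorem tendsto_concentratingBump_zero {x : EuclideanSpace ℝ (Fin d)} (hx : x ≠ x₀) :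
    Tendsto (fun n : ℕ => concentratingBump x₀ e ((n : ℝ) + 1) x) atTop (𝓝 0) := by
  have hpos : 0 < ‖x - x₀‖ := norm_pos_iff.2 (sub_ne_zero.2 hx)
  have h1 : Tendsto (fun n : ℕ => ((n : ℝ) + 1) * ‖x - x₀‖) atTop atTop :=
    (tendsto_natCast_atTop_atTop.atTop_add tendsto_const_nhds).atTop_mul_const hpos
  refine tendsto_const_nhds.congr' ?_
  filter_upwards [h1.eventually_ge_atTop 2] with n hn
  have h0 : unitBump d (((n : ℝ) + 1) • (x - x₀)) = 0 := by
    refine (unitBump d).zero_of_le_dist ?_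
    rw [dist_zero_right, norm_smul, Real.norm_of_nonneg (by positivity)]
    exact hn
  simp [concentratingBump, h0]

/-- The critical norm of the concentrating sequence has a lower bound independent of the scale. -/
theorem rpow_measure_ball_le_eLpNorm_concentratingBump [hd : Fact (2 ≤ d)] (he : ‖e‖ = 1) {k : ℝ}
    (hk : 0 < k) (hO : Metric.ball x₀ k⁻¹ ⊆ O) :
    volume (Metric.ball (0 : EuclideanSpace ℝ (Fin d)) 1) ^ (1 / (critExp d).toReal) ≤
      eLpNorm (concentratingBump x₀ e k) (critExp d) (volume.restrict O) := by
  have h2 : (2 : ℝ) ≤ d := by exact_mod_cast hd.out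
  set p : ℝ := (critExp d).toReal with hp
  have hpv : p = (d : ℝ) / ((d : ℝ) - 1) := by
    rw [hp, critExp, ENNReal.toReal_ofReal (div_nonneg (by linarith) (by linarith))]
  have hp0 : 0 < p := by rw [hpv]; exact div_pos (by linarith) (by linarith)
  have hpow : k ^ (d - 1) = (k ^ d) ^ (1 / p) := by
    rw [← Real.rpow_natCast k d, ← Real.rpow_mul hk.le, ← Real.rpow_natCast k (d - 1),
      Nat.cast_sub (by have := hd.out; omega), hpv]
    congr 1
    field_simp
    simp
  have hball : Measure.restrict volume (Metric.ball x₀ k⁻¹) ≠ 0 := by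
    rw [Ne, Measure.restrict_eq_zero]
    exact (Metric.measure_ball_pos _ _ (inv_pos.2 hk)).ne'
  -- On the ball of radius `1 / k` the function is the constant `k ^ (d - 1) • e`.
  have hconst : eLpNorm (fun _ : EuclideanSpace ℝ (Fin d) => k ^ (d - 1) • e) (critExp d)
      (volume.restrict (Metric.ball x₀ k⁻¹)) ≤
      eLpNorm (concentratingBump x₀ e k) (critExp d) (volume.restrict O) := by
    refine le_trans (le_of_eq ?_) (eLpNorm_mono_measure _ (Measure.restrict_mono hO le_rfl))
    refine eLpNorm_congr_ae ?_
    filter_upwards [ae_restrict_mem measurableSet_ball] with x hx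
    have h1 : unitBump d (k • (x - x₀)) = 1 := by
      refine (unitBump d).one_of_mem_closedBall ?_
      rw [mem_closedBall_zero_iff, norm_smul, Real.norm_of_nonneg hk.le]
      rw [mem_ball_iff_norm] at hx
      calc k * ‖x - x₀‖ ≤ k * k⁻¹ := by gcongr
        _ = 1 := mul_inv_cancel₀ hk.ne'
    rw [concentratingBump, h1, mul_one]
  refine le_trans (le_of_eq ?_) hconst
  rw [eLpNorm_const _ (by simpa using (zero_lt_one.trans_le (fact_one_le_critExp d).out).ne') hball,
    Measure.restrict_apply_univ, Measure.addHaar_ball_of_pos _ _ (inv_pos.2 hk),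
    finrank_euclideanSpace_fin, ← hp, enorm_smul, ← ofReal_norm (x := e), he, ENNReal.ofReal_one,
    mul_one, Real.enorm_of_nonneg (by positivity), hpow,
    ← ENNReal.ofReal_rpow_of_pos (by positivity),
    ← ENNReal.mul_rpow_of_nonneg _ _ (by positivity), ← mul_assoc,
    ← ENNReal.ofReal_mul (by positivity), ← mul_pow, mul_inv_cancel₀ hk.ne', one_pow,
    ENNReal.ofReal_one, one_mul]

theorem IsCompactOperator.exists_subseq_tendsto {X Y : Type*} [NormedAddCommGroup X]
    [NormedSpace ℝ X] [NormedAddCommGroup Y] [NormedSpace ℝ Y] {T : X →L[ℝ] Y}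
    (hT : IsCompactOperator T) {x : ℕ → X} {M : ℝ} (hx : ∀ n, ‖x n‖ ≤ M) :
    ∃ (y : Y) (ns : ℕ → ℕ), StrictMono ns ∧ Tendsto (fun n => T (x (ns n))) atTop (𝓝 y) := by
  obtain ⟨K, hK, hTK⟩ := IsCompactOperator.image_closedBall_subset_compact
    (f := (T : X →ₗ[ℝ] Y)) hT M
  obtain ⟨y, -, ns, hns, hlim⟩ := hK.tendsto_subseq (x := fun n => T (x n))
    fun n => hTK ⟨x n, mem_closedBall_zero_iff.2 (hx n), rfl⟩
  exact ⟨y, ns, hns, hlim⟩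

theorem eq_zero_of_tendsto_Lp_of_ae_tendsto_zero {α F : Type*} [MeasurableSpace α] {μ : Measure α}
    [NormedAddCommGroup F] {p : ℝ≥0∞} [Fact (1 ≤ p)] {f : ℕ → Lp F p μ} {g : Lp F p μ}
    (hf : Tendsto f atTop (𝓝 g)) (hae : ∀ᵐ x ∂μ, Tendsto (fun n => f n x) atTop (𝓝 0)) :
    g = 0 := by
  obtain ⟨ns, hns, hg⟩ := (tendstoInMeasure_of_tendsto_Lp hf).exists_seq_tendsto_ae
  rw [Lp.eq_zero_iff_ae_eq_zero]
  filter_upwards [hae, hg] with x h1 h2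
  exact tendsto_nhds_unique h2 (h1.comp hns.tendsto_atTop)

theorem tendsto_enorm_zero {Y : Type*} [NormedAddCommGroup Y] {y : ℕ → Y}
    (hy : Tendsto y atTop (𝓝 0)) : Tendsto (fun n => ‖y n‖ₑ) atTop (𝓝 0) := by
  simpa using hy.enorm

/-- The embedding is not compact: a bump function rescaled so as to concentrate at a point of `O`
keeps its critical norm, although it tends to zero almost everywhere. -/
theorem IsSobolevEmbedding.not_isCompactOperator [Fact (2 ≤ d)] (hO : IsOpen O) (hne : O.Nonempty)
    (hm : 0 < m) {T : W11 d m O →L[ℝ] LCrit d m O} (hT : IsSobolevEmbedding T) :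
    ¬ IsCompactOperator T := by
  intro hc
  obtain ⟨x₀, hx₀⟩ := hne
  have hd0 : 0 < d := lt_of_lt_of_le two_pos (Fact.out : 2 ≤ d)
  have : Nonempty (Fin d) := ⟨⟨0, hd0⟩⟩
  let e : EuclideanSpace ℝ (Fin m) := EuclideanSpace.single ⟨0, hm⟩ 1
  have he : ‖e‖ = 1 := by simp [e]
  let k : ℕ → ℝ := fun n => (n : ℝ) + 1
  have hk : ∀ n, 1 ≤ k n := fun n => by
    have : (0 : ℝ) ≤ n := Nat.cast_nonneg n
    linarith
  have hk0 : ∀ n, 0 < k n := fun n => one_pos.trans_le (hk n)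
  choose w hw hwn using fun n => exists_W11_ae_eq_of_contDiff O
    (contDiff_concentratingBump x₀ e (k n)) (hasCompactSupport_concentratingBump x₀ e (hk0 n))
  have hwM : ∀ n, ‖w n‖ ≤ (∫ x, ‖unitBump d x‖) + ∫ x, ‖fderiv ℝ (unitBump d) x‖ := by
    intro n
    refine (hwn n).trans ?_
    rw [integral_norm_fderiv_concentratingBump x₀ he (hk0 n)]
    linarith [integral_norm_concentratingBump_le x₀ he (hk n)]
  have hTw : ∀ n, T (w n) =ᵐ[volume.restrict O] concentratingBump x₀ e (k n) := fun n =>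
    (hT (w n)).trans (hw n)
  obtain ⟨g, ns, hns, hlim⟩ := hc.exists_subseq_tendsto hwM
  -- The functions concentrate at `x₀`, so the only possible limit is zero.
  have hg : g = 0 := by
    have hall : ∀ᵐ x ∂volume.restrict O, ∀ n, T (w n) x = concentratingBump x₀ e (k n) x :=
      ae_all_iff.2 hTw
    have hx₀ne : ∀ᵐ x ∂volume.restrict O, x ≠ x₀ :=
      ae_restrict_of_ae (Measure.ae_ne volume x₀)
    refine eq_zero_of_tendsto_Lp_of_ae_tendsto_zero hlim ?_
    filter_upwards [hall, hx₀ne] with x h2 h3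
    have h4 := (tendsto_concentratingBump_zero (e := e) x₀ h3).comp hns.tendsto_atTop
    exact h4.congr fun n => (h2 _).symm
  subst hg
  obtain ⟨r, hr, hrO⟩ := Metric.isOpen_iff.1 hO x₀ hx₀
  have hkinv : Tendsto (fun n => (k n)⁻¹) atTop (𝓝 0) := by
    simpa [k] using tendsto_one_div_add_atTop_nhds_zero_nat (𝕜 := ℝ)
  have hc0 : 0 < volume (Metric.ball (0 : EuclideanSpace ℝ (Fin d)) 1) ^
      (1 / (critExp d).toReal) := by
    refine ENNReal.rpow_pos (Metric.measure_ball_pos _ _ one_pos) measure_ball_lt_top.ne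
  have hle : ∀ᶠ n in atTop, volume (Metric.ball (0 : EuclideanSpace ℝ (Fin d)) 1) ^
      (1 / (critExp d).toReal) ≤ ‖T (w (ns n))‖ₑ := by
    filter_upwards [(hkinv.comp hns.tendsto_atTop).eventually_lt_const hr] with n hn
    have h1 := rpow_measure_ball_le_eLpNorm_concentratingBump x₀ he (hk0 (ns n))
      ((Metric.ball_subset_ball hn.le).trans hrO)
    exact (h1.trans (eLpNorm_congr_ae (hTw (ns n))).symm.le).trans (Lp.enorm_def _).symm.le
  exact (ge_of_tendsto (tendsto_enorm_zero hlim) hle).not_gt hc0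

end NonCompact

/-! ### The embedding theorem -/

theorem IsW11ExtensionDomain.exists_embedding {d m : ℕ} [Fact (2 ≤ d)]
    {O : Set (EuclideanSpace ℝ (Fin d))} (hO : IsW11ExtensionDomain d m O) :
    ∃ T : W11 d m O →L[ℝ] LCrit d m O,
      IsSobolevEmbedding T ∧ IsCompletelyContinuous T ∧
        (O.Nonempty → 0 < m → ¬ IsCompactOperator T) := by
  obtain ⟨C, hC⟩ := hO.exists_eLpNorm_le
  obtain ⟨T, hT⟩ := exists_isSobolevEmbedding hC
  exact ⟨T, hT, hT.isCompletelyContinuous hO, fun hne hm => hT.not_isCompactOperator hO.1 hne hm⟩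

theorem isW11ExtensionDomain_univ (d m : ℕ) : IsW11ExtensionDomain d m Set.univ :=
  ⟨isOpen_univ, ContinuousLinearMap.id ℝ _, fun _ => EventuallyEq.rfl⟩

theorem mainTheorem7 (d m : ℕ) [Fact (2 ≤ d)] :
    (∃ T : W11 d m Set.univ →L[ℝ] LCrit d m Set.univ,
      IsSobolevEmbedding T ∧ IsCompletelyContinuous T ∧ (0 < m → ¬ IsCompactOperator T)) ∧
    (∀ O : Set (EuclideanSpace ℝ (Fin d)), IsW11ExtensionDomain d m O →
      ∃ T : W11 d m O →L[ℝ] LCrit d m O,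
        IsSobolevEmbedding T ∧ IsCompletelyContinuous T ∧
          (O.Nonempty → 0 < m → ¬ IsCompactOperator T)) := by
  refine ⟨?_, fun O hO => hO.exists_embedding⟩
  -- The whole space is an extension domain.
  obtain ⟨T, h1, h2, h3⟩ := (isW11ExtensionDomain_univ d m).exists_embedding
  exact ⟨T, h1, h2, h3 Set.univ_nonempty⟩
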